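/- Consider $M$ sensors, $T$ time slots, an integer $K\ge 0$, vectors $\mathbf a_1,\dots,\mathbf a_M\in\mathbb R^m$, a positive definite matrix $\mathbf\Sigma_x\in\mathbb R^{m\times m}$, $\sigma_w^2>0$, channel gains $h_i[t]>0$, a slot duration $T_s>0$, and harvested energies $E_i[t]\ge 0$. Put $\xi_i[t]=(\mathbf a_i^T\mathbf\Sigma_x\mathbf a_i/\sigma_w^2+1)/h_i[t]$. In the variables $(\mathbf z,\mathbf s,\mathbf p)$, where $\mathbf z=(z_i[t])$, $\mathbf s=(s_i[t])$, $\mathbf p=(p_i[t])$, consider the non-convex problem $$\text{(P)}\qquad \min\; F(\mathbf s)=\sum_{t=1}^T \operatorname{tr}\Big[\Big(\sum_{i=1}^M \tfrac{s_i[t]}{\sigma_w^2}\mathbf a_i\mathbf a_i^T+\mathbf\Sigma_x^{-1}\Big)^{-1}\Big]$$ subject to, for all $i$ and $t$, $$s_i[t]\le \frac{p_i[t]z_i[t]}{p_i[t]+\xi_i[t]},\quad T_s\sum_{l\le t}p_i[l]\le\sum_{l\le t}E_i[l],\quad \sum_{j=1}^M z_j[t]=K,\quad 0\le z_i[t]\le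 1,\quad p_i[t]\ge 0,\quad s_i[t]\ge 0.$$ For a point $(\mathbf z^{(k)},\mathbf s^{(k)},\mathbf p^{(k)})$ let the surrogate problem $(\mathrm P_k)$ be (P) with its first constraint replaced by the convex constraint $\bar f^{(k)}+\bar g^{(k)}+s_i[t]\xi_i[t]\le 0$ where, writing $z,s,p$ for $z_i[t],s_i[t],p_i[t]$, and $z_k,s_k,p_k$ for $z^{(k)}_i[t],s^{(k)}_i[t],p^{(k)}_i[t]$, $$\bar f^{(k)}=\tfrac12(s+p)^2-\tfrac12(s_k^2+p_k^2)-s_k(s-s_k)-p_k(p-p_k),$$ $$\bar g^{(k)}=\tfrac12(z^2+p^2)-\tfrac12(z_k+p_k)^2-(z_k+p_k)(z-z_k)-(z_k+p_k)(p-p_k).$$ The algorithm starts at a feasible point of (P) and takes as iterate $k+1$ any solution of $(\mathrm P_k)$. **Claim.** The surrogate problem built at any feasible point of (P) has a solution. Suppose the starting point satisfies the following: whenever, in a slot $t$, sensor $i$ has harvested no energy so far ($\sum_{l\le t}E_i[l]=0$) and sensor $j$ has harvested some ($\sum_{l\le t}E_j[l]>0$), then $z^{(0)}_i[t]=0$ or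 $z^{(0)}_j[t]=1$. (This is no restriction if $E_i[1]>0$ for all $i$.) Then for every sequence of iterates: 1. All iterates are feasible for (P), and their objective values do not increase and converge to a real number $d$. 2. The sequence of iterates has an accumulation point. Every accumulation point is a KKT point of (P) with objective value $d$. The distance of the iterates to the set of KKT points of (P) with objective value $d$ tends to $0$. 3. If $\mathbf a_i\ne \mathbf 0$ for all $i$, then the difference of consecutive iterates tends to $\mathbf 0$. If, in addition, some accumulation point is isolated in the set of KKT points of (P) with the same objective value, then the whole sequence of iterates converges to it. Here a KKT point is a feasible point of (P) that admits multipliers, non-negative for the inequality constraints, with complementary slackness and vanishing gradient of the Lagrangian of (P) in $(\mathbf z,\mathbf s,\mathbf p)$. -/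

import Mathlib

open Filter Topology

noncomputable section

/-- Data of an energy-harvesting sensor network with `M` sensors, `T` time slots and a source in
`ℝ^m`, together with the number `K` of sensors to be selected in every slot. -/
structure SensorNetwork (m M T : ℕ) where
  /-- number of sensors selected per slot -/
  K : ℕ
  /-- coefficient vectors `a_i` of the linear observation model -/
  a : Fin M → Fin m → ℝ
  /-- covariance matrix of the source -/
  Sigma : Matrix (Fin m) (Fin m) ℝ
  /-- variance `σ_w²` of the observation noise -/
  noiseVar : ℝ
  /-- channel gains `h_i[t]` -/
  h : Fin M → Fin T → ℝ
  /-- slot duration `T_s` -/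
  Ts : ℝ
  /-- harvested energies `E_i[t]` -/
  E : Fin M → Fin T → ℝ
  Sigma_posDef : Sigma.PosDef
  noiseVar_pos : 0 < noiseVar
  h_pos : ∀ i t, 0 < h i t
  Ts_pos : 0 < Ts
  E_nonneg : ∀ i t, 0 ≤ E i t

/-- The optimization variables `(z, s, p)`, each one a family indexed by sensor and slot. -/
abbrev Point (M T : ℕ) : Type :=
  (Fin M → Fin T → ℝ) × (Fin M → Fin T → ℝ) × (Fin M → Fin T → ℝ)

/-- selection variables -/
abbrev Point.z {M T : ℕ} (x : Point M T) : Fin M → Fin T → ℝ := x.1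

/-- auxiliary variables -/
abbrev Point.s {M T : ℕ} (x : Point M T) : Fin M → Fin T → ℝ := x.2.1

/-- transmit powers -/
abbrev Point.p {M T : ℕ} (x : Point M T) : Fin M → Fin T → ℝ := x.2.2

namespace SensorNetwork

variable {m M T : ℕ} (P : SensorNetwork m M T)

/-- `ξ_i[t] = (a_iᵀ Σ_x a_i / σ_w² + 1) / h_i[t]`. -/
def xi (i : Fin M) (t : Fin T) : ℝ :=
  ((P.a i ⬝ᵥ P.Sigma.mulVec (P.a i)) / P.noiseVar + 1) / P.h i t

/-- Energy `∑_{l ≤ t} E_i[l]` harvested by sensor `i` up to and including slot `t`. -/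
def cumEnergy (i : Fin M) (t : Fin T) : ℝ := ∑ l ∈ Finset.Iic t, P.E i l

/-- The objective `∑_t tr (∑_i (s_i[t] / σ_w²) a_i a_iᵀ + Σ_x⁻¹)⁻¹`. -/
def objective (x : Point M T) : ℝ :=
  ∑ t, Matrix.trace
    ((∑ i, (x.s i t / P.noiseVar) • Matrix.vecMulVec (P.a i) (P.a i) + P.Sigma⁻¹)⁻¹)

/-- The constraints common to the relaxed problem and to its surrogates: energy causality,
selection count, box constraints on `z`, non-negativity of `p` and `s`. -/
def LinearConstraints (x : Point M T) : Prop :=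
  (∀ i t, P.Ts * ∑ l ∈ Finset.Iic t, x.p i l ≤ P.cumEnergy i t) ∧
  (∀ t, ∑ i, x.z i t = (P.K : ℝ)) ∧
  (∀ i t, 0 ≤ x.z i t ∧ x.z i t ≤ 1) ∧
  (∀ i t, 0 ≤ x.p i t) ∧
  (∀ i t, 0 ≤ x.s i t)

/-- Feasible points of the relaxed non-convex problem. -/
def Feasible (x : Point M T) : Prop :=
  (∀ i t, x.s i t ≤ x.p i t * x.z i t / (x.p i t + P.xi i t)) ∧ P.LinearConstraints x

/-- `f̄`: the product `s p = (s + p)² / 2 - (s² + p²) / 2` with its concave part linearized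
at `(s₀, p₀)`. -/
def fBar (s₀ p₀ s p : ℝ) : ℝ :=
  (s + p) ^ 2 / 2 - (s₀ ^ 2 + p₀ ^ 2) / 2 - s₀ * (s - s₀) - p₀ * (p - p₀)

/-- `ḡ`: the product `-p z = (z² + p²) / 2 - (z + p)² / 2` with its concave part linearized
at `(z₀, p₀)`. -/
def gBar (z₀ p₀ z p : ℝ) : ℝ :=
  (z ^ 2 + p ^ 2) / 2 - (z₀ + p₀) ^ 2 / 2 - (z₀ + p₀) * (z - z₀) - (z₀ + p₀) * (p - p₀)

/-- Feasible points of the convex surrogate problem built at the point `y`. -/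
def SurrogateFeasible (y x : Point M T) : Prop :=
  (∀ i t, fBar (y.s i t) (y.p i t) (x.s i t) (x.p i t)
      + gBar (y.z i t) (y.p i t) (x.z i t) (x.p i t) + x.s i t * P.xi i t ≤ 0) ∧
    P.LinearConstraints x

/-- `x` is a (global) solution of the convex surrogate problem built at `y`. -/
def SolvesSurrogate (y x : Point M T) : Prop :=
  P.SurrogateFeasible y x ∧ ∀ w, P.SurrogateFeasible y w → P.objective x ≤ P.objective w

/-- `x` is a sequence of iterates of the algorithm: it starts at a feasible point, and every
further iterate is a solution of the surrogate problem built at the preceding one. -/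
def IsRun (x : ℕ → Point M T) : Prop :=
  P.Feasible (x 0) ∧ ∀ k, P.SolvesSurrogate (x k) (x (k + 1))

/-- Lagrange multipliers: `lam` for the constraint on `s`, `beta` for energy causality, `nu` for
the selection count, `zlo` and `zup` for `0 ≤ z` and `z ≤ 1`, `eta` for `0 ≤ p`, `theta` for
`0 ≤ s`. -/
structure Multipliers (M T : ℕ) where
  lam : Fin M → Fin T → ℝ
  beta : Fin M → Fin T → ℝ
  nu : Fin T → ℝ
  zlo : Fin M → Fin T → ℝ
  zup : Fin M → Fin T → ℝ
  eta : Fin M → Fin T → ℝ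
  theta : Fin M → Fin T → ℝ

/-- The Lagrangian of the relaxed non-convex problem. -/
def lagrangian (w : Multipliers M T) (x : Point M T) : ℝ :=
  P.objective x
    + ∑ i, ∑ t, w.lam i t * (x.s i t - x.p i t * x.z i t / (x.p i t + P.xi i t))
    + ∑ i, ∑ t, w.beta i t * (P.Ts * ∑ l ∈ Finset.Iic t, x.p i l - P.cumEnergy i t)
    + ∑ t, w.nu t * (∑ i, x.z i t - (P.K : ℝ))
    - ∑ i, ∑ t, w.zlo i t * x.z i t
    + ∑ i, ∑ t, w.zup i t * (x.z i t - 1)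
    - ∑ i, ∑ t, w.eta i t * x.p i t
    - ∑ i, ∑ t, w.theta i t * x.s i t

/-- `x` satisfies the Karush-Kuhn-Tucker conditions of the relaxed non-convex problem: primal
feasibility and, for some multipliers, dual feasibility, complementary slackness, and vanishing of
the derivative of the Lagrangian in `(z, s, p)`. -/
def IsKKT (x : Point M T) : Prop :=
  P.Feasible x ∧ ∃ w : Multipliers M T,
    (∀ i t, 0 ≤ w.lam i t ∧ 0 ≤ w.beta i t ∧ 0 ≤ w.zlo i t ∧ 0 ≤ w.zup i t ∧
      0 ≤ w.eta i t ∧ 0 ≤ w.theta i t) ∧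
    (∀ i t, w.lam i t * (x.s i t - x.p i t * x.z i t / (x.p i t + P.xi i t)) = 0) ∧
    (∀ i t, w.beta i t * (P.Ts * ∑ l ∈ Finset.Iic t, x.p i l - P.cumEnergy i t) = 0) ∧
    (∀ i t, w.zlo i t * x.z i t = 0) ∧
    (∀ i t, w.zup i t * (x.z i t - 1) = 0) ∧
    (∀ i t, w.eta i t * x.p i t = 0) ∧
    (∀ i t, w.theta i t * x.s i t = 0) ∧
    HasFDerivAt (P.lagrangian w) (0 : Point M T →L[ℝ] ℝ) x

end SensorNetwork

end

/-!
Write the non-convex constraint as `c = s p - p z + s ξ ≤ 0`. The surrogate constraint built at `y`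
is `c(x) + q(x - y) ≤ 0` with a positive definite quadratic form `q` acting on each sensor and slot
separately (`surrogate_eq`). So surrogate points are feasible, `y` itself is a surrogate point, and
the objective decreases along a run; compactness of the feasible set gives solvability of the
surrogates and the existence of accumulation points.

Stationarity of an accumulation point `xs` rests on a fixed-step argument (`IsRun.gain_le_zero`): if
a direction preserves the linear constraints to first order and, at each sensor and slot, either
vanishes or decreases an active constraint strictly, then a step of one fixed small length along it
is admissible for the surrogate built at any iterate near `xs`, because `q` is of second order. A
direction of descent would therefore push the objective below its limit. Two consequences follow.
The constraint is active wherever `s_i[t]` has positive marginal value (`IsRun.cons_eq_zero`). And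
the first-order change of the objective is nonnegative along all tangent directions in `(z, p)` that
leave alone the stuck pairs, those without energy or with `z = p = 0` (`IsRun.rate_nonpos`); here a
direction is perturbed into one that points inward wherever the pair is not stuck.

With the marginal value of `s_i[t]` as multiplier of the constraint on `s_i[t]`, the remaining KKT
conditions are those of one linear program in `z` per slot and one in `p` per sensor. Their
multipliers are written down explicitly from exchange conditions: a threshold for the selection
count, and the least nonincreasing majorant of the values of power for energy causality. At stuck
pairs with `z = p = 0` these conditions hold trivially, since the values involved are zero; at pairs
without energy `z` never moves along a run, and it is the assumption on the starting point, which
persists (`IsRun.balanced_of_mapClusterPt`), that makes them compatible with the threshold.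

If all `a_i` are nonzero, all marginal values are positive. A limit `(a, b)` of consecutive iterates
satisfies `c(b) + q(b - a) ≤ 0` and `c(b) = 0`, so `a = b`; vanishing increments and an isolated
accumulation point then force convergence of the whole sequence.
-/

namespace SensorNetwork

variable {m M T : ℕ} (P : SensorNetwork m M T)

/-! ### The objective and its derivative -/

/-- The coordinate `z_i[t]` as a continuous linear functional. -/
noncomputable def zCoord (i : Fin M) (t : Fin T) : Point M T →L[ℝ] ℝ :=
  (ContinuousLinearMap.proj (R := ℝ) (φ := fun _ : Fin T => ℝ) t).comp
    ((ContinuousLinearMap.proj (R := ℝ) (φ := fun _ : Fin M => Fin T → ℝ) i).comp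
      (ContinuousLinearMap.fst ℝ _ _))

/-- The coordinate `s_i[t]` as a continuous linear functional. -/
noncomputable def sCoord (i : Fin M) (t : Fin T) : Point M T →L[ℝ] ℝ :=
  (ContinuousLinearMap.proj (R := ℝ) (φ := fun _ : Fin T => ℝ) t).comp
    ((ContinuousLinearMap.proj (R := ℝ) (φ := fun _ : Fin M => Fin T → ℝ) i).comp
      ((ContinuousLinearMap.fst ℝ _ _).comp (ContinuousLinearMap.snd ℝ _ _)))

/-- The coordinate `p_i[t]` as a continuous linear functional. -/
noncomputable def pCoord (i : Fin M) (t : Fin T) : Point M T →L[ℝ] ℝ :=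
  (ContinuousLinearMap.proj (R := ℝ) (φ := fun _ : Fin T => ℝ) t).comp
    ((ContinuousLinearMap.proj (R := ℝ) (φ := fun _ : Fin M => Fin T → ℝ) i).comp
      ((ContinuousLinearMap.snd ℝ _ _).comp (ContinuousLinearMap.snd ℝ _ _)))

@[simp] lemma zCoord_apply (i : Fin M) (t : Fin T) (x : Point M T) : zCoord i t x = x.z i t := rfl

@[simp] lemma sCoord_apply (i : Fin M) (t : Fin T) (x : Point M T) : sCoord i t x = x.s i t := rfl

@[simp] lemma pCoord_apply (i : Fin M) (t : Fin T) (x : Point M T) : pCoord i t x = x.p i t := rfl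

/-- The information matrix of slot `t`, the inverse of whose trace enters the objective. -/
noncomputable def infoMatrix (x : Point M T) (t : Fin T) : Matrix (Fin m) (Fin m) ℝ :=
  ∑ i, (x.s i t / P.noiseVar) • Matrix.vecMulVec (P.a i) (P.a i) + P.Sigma⁻¹

lemma infoMatrix_posDef {x : Point M T} (hx : ∀ i t, 0 ≤ x.s i t) (t : Fin T) :
    (P.infoMatrix x t).PosDef := by
  refine Matrix.PosDef.posSemidef_add (Matrix.posSemidef_sum _ fun i _ => ?_) P.Sigma_posDef.inv
  exact (Matrix.posSemidef_vecMulVec_self_star (P.a i)).smul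
    (div_nonneg (hx i t) P.noiseVar_pos.le)

/-- The marginal value `-∂F/∂s_i[t] = ‖B⁻¹ a_i‖² / σ_w²` of `s_i[t]`, where `B` is the information
matrix of slot `t`. -/
noncomputable def gain (x : Point M T) (i : Fin M) (t : Fin T) : ℝ :=
  ((P.infoMatrix x t)⁻¹.mulVec (P.a i) ⬝ᵥ (P.infoMatrix x t)⁻¹.mulVec (P.a i)) / P.noiseVar

lemma gain_nonneg (x : Point M T) (i : Fin M) (t : Fin T) : 0 ≤ P.gain x i t :=
  div_nonneg (Finset.sum_nonneg fun _ _ => mul_self_nonneg _) P.noiseVar_pos.le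

lemma gain_pos {x : Point M T} (hx : ∀ i t, 0 ≤ x.s i t) {i : Fin M} (ha : P.a i ≠ 0)
    (t : Fin T) : 0 < P.gain x i t := by
  refine lt_of_le_of_ne (P.gain_nonneg x i t) fun h => ha ?_
  have hB := (P.infoMatrix_posDef hx t).isUnit
  have h0 : (P.infoMatrix x t)⁻¹.mulVec (P.a i) = 0 := by
    rw [← dotProduct_self_eq_zero]
    have := h.symm
    rw [gain, div_eq_zero_iff] at this
    exact this.resolve_right P.noiseVar_pos.ne'
  have h1 := congrArg (P.infoMatrix x t).mulVec h0
  rw [Matrix.mulVec_mulVec, Matrix.mul_nonsing_inv _ ((Matrix.isUnit_iff_isUnit_det _).1 hB),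
    Matrix.one_mulVec, Matrix.mulVec_zero] at h1
  exact h1

section Derivative

attribute [local instance] Matrix.linftyOpNormedRing Matrix.linftyOpNormedAlgebra

lemma hasFDerivAt_trace_inv {x : Point M T} (hx : ∀ i t, 0 ≤ x.s i t) (t : Fin T) :
    HasFDerivAt (fun y => Matrix.trace (P.infoMatrix y t)⁻¹)
      (-∑ i, P.gain x i t • sCoord i t) x := by
  have hB := P.infoMatrix_posDef hx t
  obtain ⟨u, hu⟩ := hB.isUnit
  have h1 : HasFDerivAt (fun y => P.infoMatrix y t)
      (∑ i, ((P.noiseVar)⁻¹ • sCoord i t).smulRight (Matrix.vecMulVec (P.a i) (P.a i))) x := by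
    unfold infoMatrix
    refine HasFDerivAt.add_const _ (HasFDerivAt.fun_sum fun i _ => ?_)
    have := ((P.noiseVar)⁻¹ • sCoord i t :
      Point M T →L[ℝ] ℝ).hasFDerivAt (x := x)
    refine (this.smul_const (Matrix.vecMulVec (P.a i) (P.a i))).congr_of_eventuallyEq ?_
    refine Eventually.of_forall fun y => ?_
    simp [div_eq_inv_mul]
  have h2 := hasFDerivAt_ringInverse (𝕜 := ℝ) u
  rw [hu] at h2
  have h3 := (LinearMap.toContinuousLinearMap
    (Matrix.traceLinearMap (Fin m) ℝ ℝ)).hasFDerivAt.comp x (h2.comp x h1)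
  have hinv : (↑u⁻¹ : Matrix (Fin m) (Fin m) ℝ) = (P.infoMatrix x t)⁻¹ := by
    rw [← hu, Matrix.coe_units_inv]
  refine (h3.congr_of_eventuallyEq (Eventually.of_forall fun y => ?_)).congr_fderiv ?_
  · simp [Matrix.nonsing_inv_eq_ringInverse]
  · refine ContinuousLinearMap.ext fun v => ?_
    have hsymm : (P.infoMatrix x t)⁻¹.transpose = (P.infoMatrix x t)⁻¹ := hB.inv.isHermitian
    have key : ∀ i, Matrix.trace ((P.infoMatrix x t)⁻¹ *
        Matrix.vecMulVec (P.a i) (P.a i) * (P.infoMatrix x t)⁻¹) = P.gain x i t * P.noiseVar := by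
      intro i
      rw [Matrix.mul_vecMulVec, Matrix.vecMulVec_mul, Matrix.trace_vecMulVec, gain,
        div_mul_cancel₀ _ P.noiseVar_pos.ne', ← Matrix.mulVec_transpose, hsymm]
    have e1 : ∀ X : Matrix (Fin m) (Fin m) ℝ, (-ContinuousLinearMap.mulLeftRight ℝ
        (Matrix (Fin m) (Fin m) ℝ) ↑u⁻¹ ↑u⁻¹) X
          = -((P.infoMatrix x t)⁻¹ * X * (P.infoMatrix x t)⁻¹) := by
      intro X
      rw [neg_apply, ContinuousLinearMap.mulLeftRight_apply, hinv]
    have e2 : (∑ i, ((P.noiseVar)⁻¹ • sCoord i t).smulRight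
        (Matrix.vecMulVec (P.a i) (P.a i)) : Point M T →L[ℝ] Matrix (Fin m) (Fin m) ℝ) v
          = ∑ i, (P.noiseVar⁻¹ * v.s i t) • Matrix.vecMulVec (P.a i) (P.a i) := by
      rw [sum_apply]
      rfl
    have e3 : (-∑ i, P.gain x i t • sCoord i t : Point M T →L[ℝ] ℝ) v
        = -∑ i, P.gain x i t * v.s i t := by
      rw [neg_apply, sum_apply]
      rfl
    rw [e3]
    change Matrix.trace ((-ContinuousLinearMap.mulLeftRight ℝ
        (Matrix (Fin m) (Fin m) ℝ) ↑u⁻¹ ↑u⁻¹) ((∑ i, ((P.noiseVar)⁻¹ • sCoord i t).smulRight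
        (Matrix.vecMulVec (P.a i) (P.a i)) : Point M T →L[ℝ] Matrix (Fin m) (Fin m) ℝ) v)) = _
    rw [e1, e2, Matrix.trace_neg, Matrix.mul_sum, Matrix.sum_mul, Matrix.trace_sum]
    congr 1
    refine Finset.sum_congr rfl fun i _ => ?_
    rw [Matrix.mul_smul, Matrix.smul_mul, Matrix.trace_smul, key, smul_eq_mul]
    have := P.noiseVar_pos.ne'
    field_simp

end Derivative

lemma hasFDerivAt_objective {x : Point M T} (hx : ∀ i t, 0 ≤ x.s i t) :
    HasFDerivAt P.objective (-∑ t, ∑ i, P.gain x i t • sCoord i t) x := by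
  have := HasFDerivAt.fun_sum (u := Finset.univ) fun t _ => P.hasFDerivAt_trace_inv hx t
  rw [Finset.sum_neg_distrib] at this
  exact this

lemma continuousAt_objective {x : Point M T} (hx : ∀ i t, 0 ≤ x.s i t) :
    ContinuousAt P.objective x :=
  (P.hasFDerivAt_objective hx).continuousAt

lemma objective_nonneg {x : Point M T} (hx : ∀ i t, 0 ≤ x.s i t) : 0 ≤ P.objective x :=
  Finset.sum_nonneg fun t _ => (P.infoMatrix_posDef hx t).inv.posSemidef.trace_nonneg

/-! ### The surrogate constraint -/

lemma xi_pos (i : Fin M) (t : Fin T) : 0 < P.xi i t := by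
  have h := P.Sigma_posDef.posSemidef.dotProduct_mulVec_nonneg (P.a i)
  simp only [star_trivial] at h
  exact div_pos (add_pos_of_nonneg_of_pos (div_nonneg h P.noiseVar_pos.le) one_pos) (P.h_pos i t)

/-- The polynomial form `s p - p z + s ξ` of the non-convex constraint at sensor `i`, slot `t`. -/
noncomputable def cons (x : Point M T) (i : Fin M) (t : Fin T) : ℝ :=
  x.s i t * x.p i t - x.p i t * x.z i t + x.s i t * P.xi i t

/-- The amount by which the surrogate constraint built at `y` exceeds the non-convex one: a
positive definite quadratic form in the increment `x - y`. -/
noncomputable def prox (y x : Point M T) (i : Fin M) (t : Fin T) : ℝ :=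
  ((x.s i t - y.s i t) ^ 2 + (x.p i t - y.p i t) ^ 2
    + ((x.z i t - y.z i t) + (x.p i t - y.p i t)) ^ 2) / 2

lemma prox_nonneg (y x : Point M T) (i : Fin M) (t : Fin T) : 0 ≤ prox y x i t := by
  unfold prox; positivity

lemma surrogate_eq (y x : Point M T) (i : Fin M) (t : Fin T) :
    fBar (y.s i t) (y.p i t) (x.s i t) (x.p i t) + gBar (y.z i t) (y.p i t) (x.z i t) (x.p i t)
      + x.s i t * P.xi i t = P.cons x i t + prox y x i t := by
  unfold fBar gBar cons prox; ring

lemma surrogateFeasible_iff {y x : Point M T} :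
    P.SurrogateFeasible y x ↔
      (∀ i t, P.cons x i t + prox y x i t ≤ 0) ∧ P.LinearConstraints x := by
  simp only [SurrogateFeasible, surrogate_eq]

lemma le_div_iff_cons_nonpos {x : Point M T} {i : Fin M} {t : Fin T} (hp : 0 ≤ x.p i t) :
    x.s i t ≤ x.p i t * x.z i t / (x.p i t + P.xi i t) ↔ P.cons x i t ≤ 0 := by
  rw [le_div_iff₀ (add_pos_of_nonneg_of_pos hp (P.xi_pos i t)), cons, ← sub_nonpos]
  constructor <;> intro h <;> linarith

lemma feasible_iff {x : Point M T} :
    P.Feasible x ↔ (∀ i t, P.cons x i t ≤ 0) ∧ P.LinearConstraints x := by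
  unfold Feasible
  refine and_congr_left fun h => forall₂_congr fun i t => ?_
  exact P.le_div_iff_cons_nonpos (h.2.2.2.1 i t)

lemma SurrogateFeasible.feasible {y x : Point M T} (h : P.SurrogateFeasible y x) :
    P.Feasible x := by
  rw [surrogateFeasible_iff] at h
  exact P.feasible_iff.2 ⟨fun i t => by linarith [h.1 i t, prox_nonneg y x i t], h.2⟩

lemma Feasible.surrogateFeasible_self {y : Point M T} (h : P.Feasible y) :
    P.SurrogateFeasible y y := by
  rw [feasible_iff] at h
  exact P.surrogateFeasible_iff.2 ⟨fun i t => by simpa [prox] using h.1 i t, h.2⟩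

variable {P} in
lemma Feasible.s_nonneg {x : Point M T} (h : P.Feasible x) (i : Fin M) (t : Fin T) :
    0 ≤ x.s i t := h.2.2.2.2.2 i t

variable {P} in
lemma Feasible.p_nonneg {x : Point M T} (h : P.Feasible x) (i : Fin M) (t : Fin T) :
    0 ≤ x.p i t := h.2.2.2.2.1 i t

variable {P} in
lemma Feasible.z_mem {x : Point M T} (h : P.Feasible x) (i : Fin M) (t : Fin T) :
    0 ≤ x.z i t ∧ x.z i t ≤ 1 := h.2.2.2.1 i t

variable {P} in
lemma Feasible.cons_nonpos {x : Point M T} (h : P.Feasible x) (i : Fin M) (t : Fin T) :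
    P.cons x i t ≤ 0 := (P.feasible_iff.1 h).1 i t

variable {P} in
lemma Feasible.p_le {x : Point M T} (h : P.Feasible x) (i : Fin M) {l t : Fin T} (hl : l ≤ t) :
    P.Ts * x.p i l ≤ P.cumEnergy i t :=
  (mul_le_mul_of_nonneg_left (Finset.single_le_sum (f := fun l => x.p i l)
    (fun l _ => h.p_nonneg i l) (Finset.mem_Iic.2 hl)) P.Ts_pos.le).trans (h.2.1 i t)

variable {P} in
lemma Feasible.p_eq_zero {x : Point M T} (h : P.Feasible x) {i : Fin M} {t : Fin T}
    (hE : P.cumEnergy i t = 0) : x.p i t = 0 := by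
  have h1 := h.p_le i (le_refl t)
  rw [hE] at h1
  exact le_antisymm (nonpos_of_mul_nonpos_right h1 P.Ts_pos) (h.p_nonneg i t)

variable {P} in
lemma Feasible.s_eq_zero {x : Point M T} (h : P.Feasible x) {i : Fin M} {t : Fin T}
    (hpz : x.p i t * x.z i t = 0) : x.s i t = 0 := by
  have h1 := h.cons_nonpos i t
  have h2 := P.xi_pos i t
  have h3 := h.p_nonneg i t
  have h4 := h.s_nonneg i t
  unfold cons at h1
  rw [hpz] at h1
  nlinarith [mul_nonneg h4 h3]

lemma cumEnergy_nonneg (i : Fin M) (t : Fin T) : 0 ≤ P.cumEnergy i t :=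
  Finset.sum_nonneg fun l _ => P.E_nonneg i l

lemma cumEnergy_mono (i : Fin M) : Monotone (P.cumEnergy i) := fun _ _ h =>
  Finset.sum_le_sum_of_subset_of_nonneg (Finset.Iic_subset_Iic.2 h) fun l _ _ => P.E_nonneg i l

/-! ### Compactness and solvability of the surrogate problems -/

lemma continuous_z (i : Fin M) (t : Fin T) :
    Continuous fun x : Point M T => x.z i t := (zCoord i t).continuous

lemma continuous_s (i : Fin M) (t : Fin T) :
    Continuous fun x : Point M T => x.s i t := (sCoord i t).continuous

lemma continuous_p (i : Fin M) (t : Fin T) :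
    Continuous fun x : Point M T => x.p i t := (pCoord i t).continuous

lemma continuous_cons (i : Fin M) (t : Fin T) :
    Continuous fun x : Point M T => P.cons x i t := by
  exact (((continuous_s i t).mul (continuous_p i t)).sub
    ((continuous_p i t).mul (continuous_z i t))).add ((continuous_s i t).mul continuous_const)

lemma continuous_prox {X : Type*} [TopologicalSpace X] {f g : X → Point M T}
    (hf : Continuous f) (hg : Continuous g) (i : Fin M) (t : Fin T) :
    Continuous fun a => prox (f a) (g a) i t := by
  have hs := ((continuous_s i t).comp hg).sub ((continuous_s i t).comp hf)
  have hp := ((continuous_p i t).comp hg).sub ((continuous_p i t).comp hf)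
  have hz := ((continuous_z i t).comp hg).sub ((continuous_z i t).comp hf)
  exact (((hs.pow 2).add (hp.pow 2)).add ((hz.add hp).pow 2)).div_const 2

lemma isClosed_linearConstraints : IsClosed {x : Point M T | P.LinearConstraints x} := by
  simp only [LinearConstraints, Set.ofPred_and, Set.ofPred_forall]
  refine IsClosed.inter (isClosed_iInter fun i => isClosed_iInter fun t =>
    isClosed_le (continuous_const.mul (continuous_finsetSum _ fun l _ => continuous_p i l))
      continuous_const) (IsClosed.inter (isClosed_iInter fun t =>
    isClosed_eq (continuous_finsetSum _ fun i _ => continuous_z i t) continuous_const)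
    (IsClosed.inter (isClosed_iInter fun i => isClosed_iInter fun t =>
      (isClosed_le continuous_const (continuous_z i t)).inter
        (isClosed_le (continuous_z i t) continuous_const))
    (IsClosed.inter (isClosed_iInter fun i => isClosed_iInter fun t =>
      isClosed_le continuous_const (continuous_p i t)) (isClosed_iInter fun i =>
    isClosed_iInter fun t => isClosed_le continuous_const (continuous_s i t)))))

lemma isClosed_feasible : IsClosed {x : Point M T | P.Feasible x} := by
  simp only [feasible_iff, Set.ofPred_and, Set.ofPred_forall]
  exact (isClosed_iInter fun i => isClosed_iInter fun t =>
    isClosed_le (P.continuous_cons i t) continuous_const).inter P.isClosed_linearConstraints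

lemma isClosed_surrogateFeasible (y : Point M T) :
    IsClosed {x : Point M T | P.SurrogateFeasible y x} := by
  simp only [surrogateFeasible_iff, Set.ofPred_and, Set.ofPred_forall]
  refine (isClosed_iInter fun i => isClosed_iInter fun t =>
    isClosed_le ?_ continuous_const).inter P.isClosed_linearConstraints
  exact (P.continuous_cons i t).add
    (continuous_prox continuous_const continuous_id i t)

lemma isCompact_feasible : IsCompact {x : Point M T | P.Feasible x} := by
  let top : Point M T := (1, 1, fun i t => P.cumEnergy i t / P.Ts)
  refine (isCompact_Icc (a := (0 : Point M T)) (b := top)).of_isClosed_subset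
    P.isClosed_feasible fun x hx => ⟨⟨?_, ?_, ?_⟩, ⟨?_, ?_, ?_⟩⟩
  · exact fun i t => (hx.z_mem i t).1
  · exact fun i t => hx.s_nonneg i t
  · exact fun i t => hx.p_nonneg i t
  · exact fun i t => (hx.z_mem i t).2
  · intro i t
    have h1 := hx.p_nonneg i t
    refine (hx.1 i t).trans ?_
    change _ ≤ (1 : ℝ)
    rw [div_le_one (add_pos_of_nonneg_of_pos h1 (P.xi_pos i t))]
    nlinarith [hx.z_mem i t, P.xi_pos i t]
  · intro i t
    change x.p i t ≤ P.cumEnergy i t / P.Ts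
    rw [le_div_iff₀ P.Ts_pos, mul_comm]
    exact hx.p_le i le_rfl

lemma exists_solvesSurrogate {y : Point M T} (hy : P.Feasible y) :
    ∃ x, P.SolvesSurrogate y x := by
  have hc : IsCompact {x : Point M T | P.SurrogateFeasible y x} :=
    P.isCompact_feasible.of_isClosed_subset (P.isClosed_surrogateFeasible y)
      fun x hx => SurrogateFeasible.feasible P hx
  obtain ⟨x, hx, hmin⟩ := hc.exists_isMinOn ⟨y, Feasible.surrogateFeasible_self P hy⟩
    (f := P.objective) fun x hx =>
      (P.continuousAt_objective
        (SurrogateFeasible.feasible P hx).s_nonneg).continuousWithinAt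
  exact ⟨x, hx, fun w hw => hmin hw⟩

/-! ### Monotonicity along a run and the invariant of the frozen sensors -/

variable {P}

lemma IsRun.feasible {x : ℕ → Point M T} (h : P.IsRun x) (k : ℕ) : P.Feasible (x k) := by
  cases k with
  | zero => exact h.1
  | succ k => exact SurrogateFeasible.feasible P (h.2 k).1

lemma IsRun.antitone {x : ℕ → Point M T} (h : P.IsRun x) :
    Antitone fun k => P.objective (x k) :=
  antitone_nat_of_succ_le fun k =>
    (h.2 k).2 _ (Feasible.surrogateFeasible_self P (h.feasible k))

/-- Without harvested energy the power is zero, and then the surrogate constraint leaves no room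
to change `z`. -/
lemma IsRun.z_frozen {x : ℕ → Point M T} (h : P.IsRun x) {i : Fin M} {t : Fin T}
    (hE : P.cumEnergy i t = 0) (k : ℕ) : (x k).z i t = (x 0).z i t := by
  induction k with
  | zero => rfl
  | succ k ih =>
    rw [← ih]
    have hp := (h.feasible k).p_eq_zero hE
    have hp' := (h.feasible (k + 1)).p_eq_zero hE
    have hs := (h.feasible k).s_eq_zero (i := i) (t := t) (by rw [hp, zero_mul])
    have hs' := (h.feasible (k + 1)).s_eq_zero (i := i) (t := t) (by rw [hp', zero_mul])
    have h1 := (P.surrogateFeasible_iff.1 (h.2 k).1).1 i t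
    simp only [cons, prox, hp, hp', hs, hs'] at h1
    have h2 : ((x (k + 1)).z i t - (x k).z i t) ^ 2 ≤ 0 := by linarith
    have h3 := pow_eq_zero_iff (two_ne_zero) |>.1 (le_antisymm h2 (sq_nonneg _))
    linarith

/-- A sensor that has harvested no energy carries selection weight in a slot only if all sensors
that have harvested energy are fully selected in that slot. -/
def Balanced (P : SensorNetwork m M T) (x : Point M T) : Prop :=
  ∀ t i j, P.cumEnergy i t = 0 → 0 < P.cumEnergy j t → x.z i t = 0 ∨ x.z j t = 1

/-- If a frozen sensor carries weight, the weights of the powered sensors sum to their number, now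
as at the start, so they all stay equal to `1`. -/
lemma IsRun.balanced_of_mapClusterPt {x : ℕ → Point M T} (h : P.IsRun x) (h0 : P.Balanced (x 0))
    {xs : Point M T} (hxs : MapClusterPt xs atTop x) : P.Balanced xs := by
  have key : ∀ c i t, (∀ k, (x k).z i t = c) → xs.z i t = c := fun c i t hc =>
    (isClosed_eq (continuous_z i t) continuous_const).mem_of_mapClusterPt hxs
      (Eventually.of_forall hc)
  intro t i j hi hj
  by_cases hz : (x 0).z i t = 0
  · exact Or.inl (key 0 i t fun k => by rw [h.z_frozen hi k, hz])
  refine Or.inr (key 1 j t fun k => ?_)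
  have hall : ∀ l, 0 < P.cumEnergy l t → (x 0).z l t = 1 := fun l hl =>
    (h0 t i l hi hl).resolve_left hz
  have hsum : ∑ l, ((x 0).z l t - (x k).z l t) = 0 := by
    rw [Finset.sum_sub_distrib, (h.feasible 0).2.2.1 t, (h.feasible k).2.2.1 t, sub_self]
  have hnn : ∀ l ∈ Finset.univ, 0 ≤ (x 0).z l t - (x k).z l t := by
    intro l _
    rcases (P.cumEnergy_nonneg l t).eq_or_lt with hl | hl
    · rw [h.z_frozen hl.symm k, sub_self]
    · rw [hall l hl, sub_nonneg]
      exact ((h.feasible k).z_mem l t).2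
  have := (Finset.sum_eq_zero_iff_of_nonneg hnn).1 hsum j (Finset.mem_univ j)
  rw [hall j hj] at this
  linarith

lemma IsRun.feasible_of_mapClusterPt {x : ℕ → Point M T} (h : P.IsRun x)
    {xs : Point M T} (hxs : MapClusterPt xs atTop x) : P.Feasible xs :=
  P.isClosed_feasible.mem_of_mapClusterPt hxs (Eventually.of_forall h.feasible)

/-! ### First-order conditions at accumulation points -/

/-- The coordinate vector of sensor `i` and slot `t`. -/
def unitDir (i : Fin M) (t : Fin T) : Fin M → Fin T → ℝ :=
  fun j l => if j = i ∧ l = t then 1 else 0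

lemma unitDir_nonneg (i : Fin M) (t : Fin T) (j : Fin M) (l : Fin T) : 0 ≤ unitDir i t j l := by
  unfold unitDir; split_ifs <;> norm_num

lemma sum_mul_unitDir (c : Fin M → Fin T → ℝ) (i : Fin M) (t : Fin T) :
    ∑ l, ∑ j, c j l * unitDir i t j l = c i t := by
  simp [unitDir, ite_and]

lemma sum_unitDir (i : Fin M) (t l : Fin T) :
    ∑ j, unitDir i t j l = if l = t then 1 else 0 := by
  simp [unitDir, ite_and]

lemma sum_Iic_unitDir (i j : Fin M) (t l : Fin T) :
    ∑ r ∈ Finset.Iic l, unitDir i t j r = if j = i ∧ t ≤ l then 1 else 0 := by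
  by_cases hj : j = i <;> simp [unitDir, hj]

/-- The direction `(dz, dp)` does not leave the linear constraints to first order at `x`. -/
structure IsTangent (P : SensorNetwork m M T) (x : Point M T) (dz dp : Fin M → Fin T → ℝ) :
    Prop where
  energy : ∀ i t, P.Ts * ∑ l ∈ Finset.Iic t, x.p i l = P.cumEnergy i t →
    ∑ l ∈ Finset.Iic t, dp i l ≤ 0
  sum_z : ∀ t, ∑ i, dz i t = 0
  z_lower : ∀ i t, x.z i t = 0 → 0 ≤ dz i t
  z_upper : ∀ i t, x.z i t = 1 → dz i t ≤ 0
  p_lower : ∀ i t, x.p i t = 0 → 0 ≤ dp i t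

lemma eventually_nonneg_add_mul {X : Type*} [TopologicalSpace X] {f : X → ℝ} {x : X} {δ : ℝ}
    (hf : ContinuousAt f x) (h0 : 0 ≤ f x) (hδ : f x = 0 → 0 ≤ δ) :
    ∀ᶠ ε in 𝓝[>] (0 : ℝ), ∀ᶠ y in 𝓝 x, 0 ≤ f y → 0 ≤ f y + ε * δ := by
  rcases h0.eq_or_lt with h | h
  · filter_upwards [self_mem_nhdsWithin] with ε hε
    exact Eventually.of_forall fun y hy => add_nonneg hy (mul_nonneg (le_of_lt hε) (hδ h.symm))
  · have h1 : ContinuousAt (fun ε : ℝ => f x + ε * δ) 0 := by fun_prop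
    have h2 : ∀ᶠ ε in 𝓝 (0 : ℝ), 0 < f x + ε * δ :=
      h1.eventually (lt_mem_nhds (by simpa using h))
    filter_upwards [mem_nhdsWithin_of_mem_nhds h2] with ε hε
    filter_upwards [(hf.add continuousAt_const).eventually (lt_mem_nhds hε)] with y hy _
    exact le_of_lt hy

lemma IsTangent.eventually_linearConstraints {xs d : Point M T} (ht : P.IsTangent xs d.z d.p)
    (hxs : P.Feasible xs) (hs : ∀ i t, xs.s i t = 0 → 0 ≤ d.s i t) :
    ∀ᶠ ε in 𝓝[>] (0 : ℝ), ∀ᶠ y in 𝓝 xs, P.Feasible y → P.LinearConstraints (y + ε • d) := by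
  have hz0 := eventually_all.2 fun i => eventually_all.2 fun t => eventually_nonneg_add_mul
    (continuous_z i t).continuousAt (hxs.z_mem i t).1 (ht.z_lower i t)
  have hz1 := eventually_all.2 fun i => eventually_all.2 fun t => eventually_nonneg_add_mul
    (continuous_const.sub (continuous_z i t)).continuousAt
    (sub_nonneg.2 (hxs.z_mem i t).2) (δ := -d.z i t)
    (fun h => neg_nonneg.2 (ht.z_upper i t (sub_eq_zero.1 h).symm))
  have hp0 := eventually_all.2 fun i => eventually_all.2 fun t => eventually_nonneg_add_mul
    (continuous_p i t).continuousAt (hxs.p_nonneg i t) (ht.p_lower i t)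
  have hs0 := eventually_all.2 fun i => eventually_all.2 fun t => eventually_nonneg_add_mul
    (continuous_s i t).continuousAt (hxs.s_nonneg i t) (hs i t)
  have hE := eventually_all.2 fun i => eventually_all.2 fun t => eventually_nonneg_add_mul
    ((continuous_const (y := P.cumEnergy i t)).sub (continuous_const.mul
      (continuous_finsetSum (Finset.Iic t) fun l _ => continuous_p i l))).continuousAt
    (sub_nonneg.2 (hxs.2.1 i t)) (δ := -(P.Ts * ∑ l ∈ Finset.Iic t, d.p i l))
    (fun h => neg_nonneg.2 (mul_nonpos_of_nonneg_of_nonpos P.Ts_pos.le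
      (ht.energy i t (sub_eq_zero.1 h).symm)))
  filter_upwards [hz0, hz1, hp0, hs0, hE] with ε hz0 hz1 hp0 hs0 hE
  filter_upwards [eventually_all.2 fun i => eventually_all.2 (hz0 i),
    eventually_all.2 fun i => eventually_all.2 (hz1 i),
    eventually_all.2 fun i => eventually_all.2 (hp0 i),
    eventually_all.2 fun i => eventually_all.2 (hs0 i),
    eventually_all.2 fun i => eventually_all.2 (hE i)] with y hz0 hz1 hp0 hs0 hE hy
  refine ⟨fun i t => ?_, fun t => ?_, fun i t => ⟨?_, ?_⟩, fun i t => ?_, fun i t => ?_⟩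
  · have h : 0 ≤ P.cumEnergy i t - P.Ts * ∑ l ∈ Finset.Iic t, y.p i l
        + ε * -(P.Ts * ∑ l ∈ Finset.Iic t, d.p i l) := hE i t (sub_nonneg.2 (hy.2.1 i t))
    change P.Ts * ∑ l ∈ Finset.Iic t, (y.p i l + ε * d.p i l) ≤ _
    rw [Finset.sum_add_distrib, ← Finset.mul_sum]
    linarith
  · change ∑ i, (y.z i t + ε * d.z i t) = _
    rw [Finset.sum_add_distrib, ← Finset.mul_sum, ht.sum_z t, mul_zero, add_zero]
    exact hy.2.2.1 t
  · exact hz0 i t (hy.z_mem i t).1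
  · have h : 0 ≤ 1 - y.z i t + ε * -d.z i t := hz1 i t (sub_nonneg.2 (hy.z_mem i t).2)
    change y.z i t + ε * d.z i t ≤ 1
    linarith
  · exact hp0 i t (hy.p_nonneg i t)
  · exact hs0 i t (hy.s_nonneg i t)

/-- The proximal term is of second order in the step length, so a direction that strictly
decreases an active constraint to first order keeps the surrogate constraint satisfied. -/
lemma eventually_surrogate_constraint {xs d : Point M T} (hxs : P.Feasible xs)
    (i : Fin M) (t : Fin T)
    (hc : (d.z i t = 0 ∧ d.s i t = 0 ∧ d.p i t = 0) ∨ P.cons xs i t < 0 ∨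
      (xs.p i t + P.xi i t) * d.s i t + (xs.s i t - xs.z i t) * d.p i t
        - xs.p i t * d.z i t < 0) :
    ∀ᶠ ε in 𝓝[>] (0 : ℝ), ∀ᶠ y in 𝓝 xs, P.Feasible y →
      P.cons (y + ε • d) i t + prox y (y + ε • d) i t ≤ 0 := by
  rcases hc with h | hc
  · refine Eventually.of_forall fun ε => Eventually.of_forall fun y hy => ?_
    have hz : (y + ε • d).z i t = y.z i t := by
      change y.z i t + ε * d.z i t = _; rw [h.1]; ring
    have hs : (y + ε • d).s i t = y.s i t := by
      change y.s i t + ε * d.s i t = _; rw [h.2.1]; ring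
    have hp : (y + ε • d).p i t = y.p i t := by
      change y.p i t + ε * d.p i t = _; rw [h.2.2]; ring
    have h1 := hy.cons_nonpos i t
    unfold cons at h1
    simp only [cons, prox, hz, hs, hp]
    linarith
  · set c₁ := (xs.p i t + P.xi i t) * d.s i t + (xs.s i t - xs.z i t) * d.p i t
        - xs.p i t * d.z i t with hc₁
    set c₂ := d.s i t * d.p i t - d.p i t * d.z i t
      + ((d.s i t) ^ 2 + (d.p i t) ^ 2 + (d.z i t + d.p i t) ^ 2) / 2 with hc₂
    have hexp : ∀ ε : ℝ, P.cons (xs + ε • d) i t + prox xs (xs + ε • d) i t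
        = P.cons xs i t + ε * (c₁ + ε * c₂) := by
      intro ε
      change (xs.s i t + ε * d.s i t) * (xs.p i t + ε * d.p i t)
        - (xs.p i t + ε * d.p i t) * (xs.z i t + ε * d.z i t)
        + (xs.s i t + ε * d.s i t) * P.xi i t
        + ((xs.s i t + ε * d.s i t - xs.s i t) ^ 2 + (xs.p i t + ε * d.p i t - xs.p i t) ^ 2
          + ((xs.z i t + ε * d.z i t - xs.z i t)
            + (xs.p i t + ε * d.p i t - xs.p i t)) ^ 2) / 2 = _
      rw [hc₁, hc₂, cons]
      ring
    have hneg : ∀ᶠ ε in 𝓝[>] (0 : ℝ), P.cons xs i t + ε * (c₁ + ε * c₂) < 0 := by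
      rcases hc with hc | hc
      · have h1 : ContinuousAt (fun ε : ℝ => P.cons xs i t + ε * (c₁ + ε * c₂)) 0 := by fun_prop
        exact mem_nhdsWithin_of_mem_nhds (h1.eventually (gt_mem_nhds (by simpa using hc)))
      · have h1 : ContinuousAt (fun ε : ℝ => c₁ + ε * c₂) 0 := by fun_prop
        filter_upwards [self_mem_nhdsWithin, mem_nhdsWithin_of_mem_nhds
          (h1.eventually (gt_mem_nhds (by simpa using hc)))] with ε hε h2
        have := mul_neg_of_pos_of_neg (show (0 : ℝ) < ε from hε) h2
        linarith [hxs.cons_nonpos i t]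
    filter_upwards [hneg] with ε hε
    have hcont : Continuous fun y : Point M T =>
        P.cons (y + ε • d) i t + prox y (y + ε • d) i t := by
      have h1 : Continuous fun y : Point M T => y + ε • d := continuous_id.add continuous_const
      have h3 : Continuous fun y : Point M T => P.cons (y + ε • d) i t :=
        (P.continuous_cons i t).comp h1
      exact h3.add (continuous_prox continuous_id h1 i t)
    rw [← hexp] at hε
    filter_upwards [hcont.continuousAt.eventually (gt_mem_nhds hε)] with y hy _
    exact le_of_lt hy

lemma eventually_objective_lt {xs d : Point M T} (hxs : P.Feasible xs)
    (hd : 0 < ∑ t, ∑ i, P.gain xs i t * d.s i t) :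
    ∀ᶠ ε in 𝓝[>] (0 : ℝ), P.objective (xs + ε • d) < P.objective xs := by
  have h1 := (P.hasFDerivAt_objective hxs.s_nonneg).hasLineDerivAt d
  have h2 : (-∑ t, ∑ i, P.gain xs i t • sCoord i t : Point M T →L[ℝ] ℝ) d
      = -∑ t, ∑ i, P.gain xs i t * d.s i t := by
    simp only [neg_apply, sum_apply, smul_apply, sCoord_apply, smul_eq_mul]
  rw [h2] at h1
  have h3 := (hasDerivAt_iff_tendsto_slope_zero.1 h1).mono_left
    (nhdsWithin_mono 0 fun ε (hε : 0 < ε) => hε.ne')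
  filter_upwards [self_mem_nhdsWithin, h3.eventually (gt_mem_nhds (neg_lt_zero.2 hd))]
    with ε hε h4
  simp only [zero_add, zero_smul, add_zero, smul_eq_mul] at h4
  have h5 := neg_of_mul_neg_right h4 (inv_pos.2 (show (0 : ℝ) < ε from hε)).le
  linarith

/-- A run that comes close to `xs` infinitely often can, from each such iterate, make the same
fixed step along `(dz, ds, dp)`; if this were a direction of descent, the objective would
eventually fall below its value at `xs`. -/
lemma IsRun.gain_le_zero {x : ℕ → Point M T} (hx : P.IsRun x) {xs : Point M T}
    (hcl : MapClusterPt xs atTop x) (hle : ∀ k, P.objective xs ≤ P.objective (x k))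
    {dz ds dp : Fin M → Fin T → ℝ}
    (ht : P.IsTangent xs dz dp) (hs : ∀ i t, xs.s i t = 0 → 0 ≤ ds i t)
    (hc : ∀ i t, (dz i t = 0 ∧ ds i t = 0 ∧ dp i t = 0) ∨ P.cons xs i t < 0 ∨
      (xs.p i t + P.xi i t) * ds i t + (xs.s i t - xs.z i t) * dp i t
        - xs.p i t * dz i t < 0) :
    ∑ t, ∑ i, P.gain xs i t * ds i t ≤ 0 := by
  set d : Point M T := (dz, ds, dp)
  by_contra! hpos
  have hxs := hx.feasible_of_mapClusterPt hcl
  obtain ⟨ε, hlin, hsur, hobj⟩ := ((IsTangent.eventually_linearConstraints (d := d) ht hxs hs).and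
    ((eventually_all.2 fun i => eventually_all.2 fun t =>
      eventually_surrogate_constraint (d := d) hxs i t (hc i t)).and
    (eventually_objective_lt (d := d) hxs hpos))).exists
  have hcont : ContinuousAt (fun y : Point M T => P.objective (y + ε • d)) xs := by
    refine ContinuousAt.comp (f := fun y : Point M T => y + ε • d)
      (P.continuousAt_objective ?_) (continuous_id.add continuous_const).continuousAt
    exact (hlin.self_of_nhds hxs).2.2.2.2
  obtain ⟨k, hk1, hk2, hk3⟩ := (hcl.frequently (hlin.and
    ((eventually_all.2 fun i => eventually_all.2 fun t => hsur i t).and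
      (hcont.eventually (gt_mem_nhds hobj))))).exists
  have hf := hx.feasible k
  have hstep := (hx.2 k).2 (x k + ε • d)
    (P.surrogateFeasible_iff.2 ⟨fun i t => hk2 i t hf, hk1 hf⟩)
  linarith [hle (k + 1)]

/-- The constraint is active at an accumulation point wherever `s_i[t]` has positive value. -/
lemma IsRun.cons_eq_zero {x : ℕ → Point M T} (hx : P.IsRun x) {xs : Point M T}
    (hcl : MapClusterPt xs atTop x) (hle : ∀ k, P.objective xs ≤ P.objective (x k))
    {i : Fin M} {t : Fin T} (hg : 0 < P.gain xs i t) : P.cons xs i t = 0 := by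
  by_contra hne
  have hlt := lt_of_le_of_ne ((hx.feasible_of_mapClusterPt hcl).cons_nonpos i t) hne
  have h := hx.gain_le_zero hcl hle (dz := 0) (ds := unitDir i t) (dp := 0)
    ⟨by simp, by simp, by simp, by simp, by simp⟩ (fun j l _ => unitDir_nonneg i t j l)
    (fun j l => by
      by_cases hj : j = i ∧ l = t
      · obtain ⟨rfl, rfl⟩ := hj
        exact Or.inr (Or.inl hlt)
      · exact Or.inl ⟨rfl, if_neg hj, rfl⟩)
  rw [sum_mul_unitDir] at h
  exact absurd h (not_le.2 hg)

/-! ### Variations of selection weights and powers -/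

/-- The partial derivative in `z` of `p z / (p + ξ)` at sensor `i`, slot `t`. -/
noncomputable def zRate (P : SensorNetwork m M T) (x : Point M T) (i : Fin M) (t : Fin T) : ℝ :=
  x.p i t / (x.p i t + P.xi i t)

/-- The partial derivative in `p` of `p z / (p + ξ)` at sensor `i`, slot `t`. -/
noncomputable def pRate (P : SensorNetwork m M T) (x : Point M T) (i : Fin M) (t : Fin T) : ℝ :=
  x.z i t * P.xi i t / (x.p i t + P.xi i t) ^ 2

/-- Sensor `i` is stuck in slot `t`: either it has no power to spend, or `z` and `p` both vanish
there and the proximal term outweighs every gain from moving them. -/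
def IsStuck (P : SensorNetwork m M T) (x : Point M T) (i : Fin M) (t : Fin T) : Prop :=
  P.cumEnergy i t = 0 ∨ (x.z i t = 0 ∧ x.p i t = 0)

lemma Feasible.denom_pos {x : Point M T} (h : P.Feasible x) (i : Fin M) (t : Fin T) :
    0 < x.p i t + P.xi i t := add_pos_of_nonneg_of_pos (h.p_nonneg i t) (P.xi_pos i t)

lemma Feasible.zRate_nonneg {x : Point M T} (h : P.Feasible x) (i : Fin M) (t : Fin T) :
    0 ≤ P.zRate x i t := div_nonneg (h.p_nonneg i t) (h.denom_pos i t).le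

lemma Feasible.pRate_nonneg {x : Point M T} (h : P.Feasible x) (i : Fin M) (t : Fin T) :
    0 ≤ P.pRate x i t :=
  div_nonneg (mul_nonneg (h.z_mem i t).1 (P.xi_pos i t).le) (sq_nonneg _)

lemma nonpos_of_forall_le_mul {S C : ℝ} (h : ∀ μ ∈ Set.Ioo (0 : ℝ) 1, S ≤ μ * C) : S ≤ 0 := by
  have h1 : Tendsto (fun μ : ℝ => μ * C) (𝓝[>] 0) (𝓝 0) := by
    have : ContinuousAt (fun μ : ℝ => μ * C) 0 := by fun_prop
    simpa [ContinuousAt] using this.mono_left (nhdsWithin_le_nhds (s := Set.Ioi 0))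
  exact ge_of_tendsto h1 (by
    filter_upwards [Ioo_mem_nhdsGT (zero_lt_one' ℝ)] with μ hμ using h μ hμ)

/-- Where the constraint is active, its gradient is the one of `s - p z / (p + ξ)` up to the
factor `p + ξ`. -/
lemma Feasible.gradient_eq {x : Point M T} (h : P.Feasible x) {i : Fin M} {t : Fin T}
    (hc : P.cons x i t = 0) (a b c : ℝ) :
    (x.p i t + P.xi i t) * b + (x.s i t - x.z i t) * c - x.p i t * a
      = (x.p i t + P.xi i t) * (b - (P.zRate x i t * a + P.pRate x i t * c)) := by
  have hd := (h.denom_pos i t).ne'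
  have hs : x.s i t = x.p i t * x.z i t / (x.p i t + P.xi i t) := by
    rw [eq_div_iff hd]; unfold cons at hc; linarith
  rw [hs, zRate, pRate]
  field_simp
  ring

/-- First-order optimality along directions that enter the interior wherever the sensor is not
stuck: then `s` can be moved slightly less than proportionally to `p z / (p + ξ)`. -/
lemma IsRun.rate_nonpos_of_strict {x : ℕ → Point M T} (hx : P.IsRun x) {xs : Point M T}
    (hcl : MapClusterPt xs atTop x) (hle : ∀ k, P.objective xs ≤ P.objective (x k))
    {dz dp : Fin M → Fin T → ℝ} (ht : P.IsTangent xs dz dp)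
    (hstuck : ∀ i t, P.IsStuck xs i t → dz i t = 0 ∧ dp i t = 0)
    (hstrict : ∀ i t, ¬ P.IsStuck xs i t →
      (xs.z i t = 0 → 0 < dz i t) ∧ (xs.p i t = 0 → 0 < dp i t)) :
    ∑ t, ∑ i, P.gain xs i t * (P.zRate xs i t * dz i t + P.pRate xs i t * dp i t) ≤ 0 := by
  have hxs := hx.feasible_of_mapClusterPt hcl
  set r : Fin M → Fin T → ℝ := fun i t => P.zRate xs i t * dz i t + P.pRate xs i t * dp i t
    with hr
  have hr0 : ∀ i t, P.IsStuck xs i t → r i t = 0 := fun i t h => by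
    simp [hr, (hstuck i t h).1, (hstuck i t h).2]
  have hs0 : ∀ i t, P.IsStuck xs i t → xs.s i t = 0 := fun i t h => hxs.s_eq_zero <| by
    rcases h with h | h
    · rw [hxs.p_eq_zero h, zero_mul]
    · rw [h.2, zero_mul]
  have hrpos : ∀ i t, ¬ P.IsStuck xs i t → P.cons xs i t = 0 → xs.s i t = 0 → 0 < r i t := by
    intro i t hns hc hs
    have hd := hxs.denom_pos i t
    have hpz : xs.p i t * xs.z i t = 0 := by
      simp only [cons, hs] at hc; linarith
    rcases mul_eq_zero.1 hpz with hp | hz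
    · have hz : 0 < xs.z i t := lt_of_le_of_ne (hxs.z_mem i t).1
        fun h => hns (Or.inr ⟨h.symm, hp⟩)
      have h1 : P.zRate xs i t = 0 := by simp [zRate, hp]
      have h2 : 0 < P.pRate xs i t := div_pos (mul_pos hz (P.xi_pos i t)) (pow_pos hd 2)
      simp only [hr, h1, zero_mul, zero_add]
      exact mul_pos h2 ((hstrict i t hns).2 hp)
    · have hp : 0 < xs.p i t := lt_of_le_of_ne (hxs.p_nonneg i t)
        fun h => hns (Or.inr ⟨hz, h.symm⟩)
      have h1 : P.pRate xs i t = 0 := by simp [pRate, hz]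
      simp only [hr, h1, zero_mul, add_zero]
      exact mul_pos (div_pos hp hd) ((hstrict i t hns).1 hz)
  refine nonpos_of_forall_le_mul (C := ∑ t, ∑ i, P.gain xs i t * (|r i t| + xs.s i t))
    fun μ hμ => ?_
  classical
  -- The share `μ` held back from the first-order change of `p z / (p + ξ)` makes the constraint
  -- strictly slack; it must vanish with `s` at stuck pairs and leave `ds ≥ 0` where `s = 0`.
  -- Where the constraint is slack, the gain is zero and `s` need not move.
  set ds : Fin M → Fin T → ℝ := fun i t =>
    if P.cons xs i t = 0 then r i t - μ * (|r i t| + xs.s i t) else 0 with hds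
  have hmain := hx.gain_le_zero hcl hle (ds := ds) ht
    (fun i t hs => by
      by_cases hc : P.cons xs i t = 0
      · simp only [hds, if_pos hc, hs, add_zero]
        by_cases hst : P.IsStuck xs i t
        · simp [hr0 i t hst]
        · have h := hrpos i t hst hc hs
          rw [abs_of_pos h]
          nlinarith [hμ.2]
      · simp [hds, if_neg hc])
    (fun i t => by
      by_cases hst : P.IsStuck xs i t
      · refine Or.inl ⟨(hstuck i t hst).1, ?_, (hstuck i t hst).2⟩
        simp [hds, hr0 i t hst, hs0 i t hst]
      refine Or.inr ?_
      rcases (hxs.cons_nonpos i t).lt_or_eq with hc | hc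
      · exact Or.inl hc
      refine Or.inr ?_
      have hpos : 0 < |r i t| + xs.s i t := by
        rcases (hxs.s_nonneg i t).eq_or_lt with hs | hs
        · have h := abs_pos.2 (hrpos i t hst hc hs.symm).ne'
          linarith
        · linarith [abs_nonneg (r i t)]
      rw [hxs.gradient_eq hc]
      refine mul_neg_of_pos_of_neg (hxs.denom_pos i t) ?_
      simp only [hds, if_pos hc]
      have := mul_pos hμ.1 hpos
      linarith)
  have hsum : ∑ t, ∑ i, P.gain xs i t * ds i t = ∑ t, ∑ i, P.gain xs i t * r i t
      - μ * ∑ t, ∑ i, P.gain xs i t * (|r i t| + xs.s i t) := by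
    simp only [Finset.mul_sum, ← Finset.sum_sub_distrib]
    refine Finset.sum_congr rfl fun t _ => Finset.sum_congr rfl fun i _ => ?_
    by_cases hc : P.cons xs i t = 0
    · simp only [hds, if_pos hc]; ring
    · have hg : P.gain xs i t = 0 := by
        by_contra hg
        exact hc (hx.cons_eq_zero hcl hle (lt_of_le_of_ne (P.gain_nonneg xs i t) (Ne.symm hg)))
      simp [hg]
  linarith

/-- In a slot with positive total weight, weight can be shifted to the sensors of weight zero
that are not stuck, from one that has positive weight and is not stuck. -/
lemma Feasible.exists_strict_column {x : Point M T} (h : P.Feasible x) (hK : P.K ≠ 0)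
    (hbal : P.Balanced x) (t : Fin T) : ∃ c : Fin M → ℝ, ∑ i, c i = 0 ∧
      ∀ i, (P.IsStuck x i t → c i = 0) ∧ (¬ P.IsStuck x i t → x.z i t = 0 → 0 < c i) ∧
        (x.z i t = 1 → c i ≤ 0) := by
  classical
  set A : Finset (Fin M) := Finset.univ.filter fun i => ¬ P.IsStuck x i t ∧ x.z i t = 0 with hA
  have hmem : ∀ i, i ∈ A ↔ ¬ P.IsStuck x i t ∧ x.z i t = 0 := fun i => by simp [hA]
  rcases A.eq_empty_or_nonempty with hAe | ⟨a, ha⟩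
  · refine ⟨0, by simp, fun i => ⟨fun _ => rfl, fun h1 h2 => ?_, fun _ => le_rfl⟩⟩
    exact absurd ((hmem i).2 ⟨h1, h2⟩) (by simp [hAe])
  obtain ⟨has, haz⟩ := (hmem a).1 ha
  have haE : 0 < P.cumEnergy a t :=
    lt_of_le_of_ne (P.cumEnergy_nonneg a t) fun he => has (Or.inl he.symm)
  obtain ⟨b, hb⟩ : ∃ b, 0 < x.z b t := by
    by_contra! hno
    have : ∑ i, x.z i t ≤ 0 := Finset.sum_nonpos fun i _ => hno i
    rw [h.2.2.1 t] at this
    exact hK (by exact_mod_cast le_antisymm this (Nat.cast_nonneg _))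
  have hbs : ¬ P.IsStuck x b t := by
    rintro (he | he)
    · rcases hbal t b a he haE with h1 | h1
      · exact hb.ne' h1
      · rw [haz] at h1; exact zero_ne_one h1
    · exact hb.ne' he.1
  have hbA : b ∉ A := fun hm => hb.ne' ((hmem b).1 hm).2
  refine ⟨fun i => (if i ∈ A then 1 else 0) - (if i = b then (A.card : ℝ) else 0), ?_,
    fun i => ⟨fun hi => ?_, fun h1 h2 => ?_, fun h1 => ?_⟩⟩
  · simp [Finset.sum_sub_distrib]
  · have h1 : i ∉ A := fun hm => ((hmem i).1 hm).1 hi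
    have h2 : i ≠ b := fun he => hbs (he ▸ hi)
    simp [h1, h2]
  · have h3 : i ∈ A := (hmem i).2 ⟨h1, h2⟩
    have h4 : i ≠ b := fun he => hbA (he ▸ h3)
    simp [h3, h4]
  · have h2 : i ∉ A := fun hm => by
      rw [((hmem i).1 hm).2] at h1; exact zero_ne_one h1
    simp only [if_neg h2, zero_sub, neg_nonpos]
    split_ifs <;> positivity

/-- A power level small enough to be spent in every slot by every sensor that has harvested
energy. -/
lemma exists_power_unit (P : SensorNetwork m M T) : ∃ η > 0, ∀ i t, 0 < P.cumEnergy i t →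
    P.Ts * (T * η) ≤ P.cumEnergy i t := by
  have h1 : ∀ i t, ∀ᶠ η in 𝓝[>] (0 : ℝ), 0 < P.cumEnergy i t →
      P.Ts * (T * η) ≤ P.cumEnergy i t := by
    intro i t
    by_cases hE : 0 < P.cumEnergy i t
    · have h2 : ContinuousAt (fun η : ℝ => P.Ts * (T * η)) 0 := by fun_prop
      filter_upwards [mem_nhdsWithin_of_mem_nhds (h2.eventually_lt_const
        (u := P.cumEnergy i t) (by simpa using hE))] with η hη _ using le_of_lt hη
    · exact Eventually.of_forall fun η h => absurd h hE
  obtain ⟨η, h2, h3⟩ := ((eventually_all.2 fun i => eventually_all.2 (h1 i)).and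
    (self_mem_nhdsWithin (s := Set.Ioi (0 : ℝ)))).exists
  exact ⟨η, h3, h2⟩

/-- A direction that enters the interior of the linear constraints wherever the sensor is not
stuck. -/
lemma Feasible.exists_strict_direction {x : Point M T} (h : P.Feasible x) (hK : P.K ≠ 0)
    (hbal : P.Balanced x) : ∃ dz dp : Fin M → Fin T → ℝ, P.IsTangent x dz dp ∧
      (∀ i t, P.IsStuck x i t → dz i t = 0 ∧ dp i t = 0) ∧
      ∀ i t, ¬ P.IsStuck x i t →
        (x.z i t = 0 → 0 < dz i t) ∧ (x.p i t = 0 → 0 < dp i t) := by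
  classical
  choose c hc0 hc using h.exists_strict_column hK hbal
  obtain ⟨η, hη, hηE⟩ := P.exists_power_unit
  have hstuck : ∀ i t, P.IsStuck x i t → x.p i t = 0 := by
    rintro i t (he | he)
    · exact h.p_eq_zero he
    · exact he.2
  refine ⟨fun i t => c t i, fun i t => (if P.IsStuck x i t then 0 else η) - x.p i t,
    ⟨fun i t htight => ?_, hc0, fun i t hz => ?_, fun i t => (hc t i).2.2, fun i t hp => ?_⟩,
    fun i t hs => ⟨(hc t i).1 hs, by simp [hs, hstuck i t hs]⟩,
    fun i t hs => ⟨(hc t i).2.1 hs, fun hp => by simpa [hs, hp] using hη⟩⟩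
  · rw [Finset.sum_sub_distrib, sub_nonpos]
    refine le_of_mul_le_mul_left ?_ P.Ts_pos
    rw [htight]
    rcases (P.cumEnergy_nonneg i t).eq_or_lt with hE | hE
    · rw [← hE]
      refine le_of_eq (mul_eq_zero_of_right _ (Finset.sum_eq_zero fun l hl => if_pos (Or.inl ?_)))
      exact le_antisymm (hE ▸ P.cumEnergy_mono i (Finset.mem_Iic.1 hl)) (P.cumEnergy_nonneg i l)
    · refine le_trans (mul_le_mul_of_nonneg_left ?_ P.Ts_pos.le) (hηE i t hE)
      calc ∑ l ∈ Finset.Iic t, (if P.IsStuck x i l then 0 else η)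
          ≤ ∑ l ∈ Finset.Iic t, η := Finset.sum_le_sum fun l _ => by split_ifs <;> linarith
        _ = (Finset.Iic t).card * η := by simp
        _ ≤ T * η := by
          refine mul_le_mul_of_nonneg_right ?_ hη.le
          exact_mod_cast (Finset.card_le_univ _).trans_eq (Fintype.card_fin T)
  · by_cases hs : P.IsStuck x i t
    · exact ((hc t i).1 hs).ge
    · exact ((hc t i).2.1 hs hz).le
  · simp only [hp, sub_zero]
    split_ifs <;> linarith

lemma IsTangent.add_mul {x : Point M T} {dz dp ez ep : Fin M → Fin T → ℝ}
    (hd : P.IsTangent x dz dp) (he : P.IsTangent x ez ep) {μ : ℝ} (hμ : 0 ≤ μ) :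
    P.IsTangent x (fun i t => dz i t + μ * ez i t) (fun i t => dp i t + μ * ep i t) where
  energy i t h := by
    rw [Finset.sum_add_distrib, ← Finset.mul_sum]
    have := mul_nonpos_of_nonneg_of_nonpos hμ (he.energy i t h)
    linarith [hd.energy i t h]
  sum_z t := by rw [Finset.sum_add_distrib, ← Finset.mul_sum, hd.sum_z, he.sum_z]; ring
  z_lower i t h := add_nonneg (hd.z_lower i t h) (mul_nonneg hμ (he.z_lower i t h))
  z_upper i t h :=
    add_nonpos (hd.z_upper i t h) (mul_nonpos_of_nonneg_of_nonpos hμ (he.z_upper i t h))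
  p_lower i t h := add_nonneg (hd.p_lower i t h) (mul_nonneg hμ (he.p_lower i t h))

/-- First-order optimality at an accumulation point along all tangent directions that leave the
stuck sensors alone. -/
lemma IsRun.rate_nonpos {x : ℕ → Point M T} (hx : P.IsRun x) {xs : Point M T}
    (hcl : MapClusterPt xs atTop x) (hle : ∀ k, P.objective xs ≤ P.objective (x k))
    (hK : P.K ≠ 0) (hbal : P.Balanced xs)
    {dz dp : Fin M → Fin T → ℝ} (ht : P.IsTangent xs dz dp)
    (hstuck : ∀ i t, P.IsStuck xs i t → dz i t = 0 ∧ dp i t = 0) :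
    ∑ t, ∑ i, P.gain xs i t * (P.zRate xs i t * dz i t + P.pRate xs i t * dp i t) ≤ 0 := by
  obtain ⟨ez, ep, he, hestuck, hestrict⟩ :=
    (hx.feasible_of_mapClusterPt hcl).exists_strict_direction hK hbal
  refine nonpos_of_forall_le_mul (C := -∑ t, ∑ i, P.gain xs i t *
    (P.zRate xs i t * ez i t + P.pRate xs i t * ep i t)) fun μ hμ => ?_
  have h := hx.rate_nonpos_of_strict hcl hle (ht.add_mul he hμ.1.le)
    (fun i t hs => by simp [hstuck i t hs, hestuck i t hs])
    (fun i t hs => ⟨fun hz => add_pos_of_nonneg_of_pos (ht.z_lower i t hz)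
      (mul_pos hμ.1 ((hestrict i t hs).1 hz)), fun hp => add_pos_of_nonneg_of_pos
      (ht.p_lower i t hp) (mul_pos hμ.1 ((hestrict i t hs).2 hp))⟩)
  have hsum : ∑ t, ∑ i, P.gain xs i t * (P.zRate xs i t * (dz i t + μ * ez i t)
        + P.pRate xs i t * (dp i t + μ * ep i t))
      = ∑ t, ∑ i, P.gain xs i t * (P.zRate xs i t * dz i t + P.pRate xs i t * dp i t)
        + μ * ∑ t, ∑ i, P.gain xs i t * (P.zRate xs i t * ez i t + P.pRate xs i t * ep i t) := by
    simp only [Finset.mul_sum, ← Finset.sum_add_distrib]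
    refine Finset.sum_congr rfl fun t _ => Finset.sum_congr rfl fun i _ => ?_
    ring
  rw [hsum] at h
  linarith

lemma Feasible.K_ne_zero {x : Point M T} (h : P.Feasible x) {i : Fin M} {t : Fin T}
    (hz : 0 < x.z i t) : P.K ≠ 0 := by
  intro hK
  have h1 := h.2.2.1 t
  rw [hK, Nat.cast_zero, Finset.sum_eq_zero_iff_of_nonneg fun j _ => (h.z_mem j t).1] at h1
  exact hz.ne' (h1 i (Finset.mem_univ i))

/-! ### Exchange conditions -/

/-- Selection weight cannot be shifted profitably between two sensors. -/
lemma IsRun.weight_exchange {x : ℕ → Point M T} (hx : P.IsRun x) {xs : Point M T}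
    (hcl : MapClusterPt xs atTop x) (hle : ∀ k, P.objective xs ≤ P.objective (x k))
    (hbal : P.Balanced xs) {i j : Fin M} {t : Fin T} (hi : 0 < xs.z i t) (hj : xs.z j t < 1) :
    P.gain xs j t * P.zRate xs j t ≤ P.gain xs i t * P.zRate xs i t := by
  have hxs := hx.feasible_of_mapClusterPt hcl
  rcases (hxs.p_nonneg j t).eq_or_lt with hp | hp
  · have : P.zRate xs j t = 0 := by simp [zRate, ← hp]
    rw [this, mul_zero]
    exact mul_nonneg (P.gain_nonneg xs i t) (hxs.zRate_nonneg i t)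
  have hjE : P.cumEnergy j t ≠ 0 := fun hE => hp.ne' (hxs.p_eq_zero hE)
  have hjs : ¬ P.IsStuck xs j t := by
    rintro (h | h)
    · exact hjE h
    · exact hp.ne' h.2
  have his : ¬ P.IsStuck xs i t := by
    rintro (h | h)
    · rcases hbal t i j h (lt_of_le_of_ne (P.cumEnergy_nonneg j t) hjE.symm) with h1 | h1
      · exact hi.ne' h1
      · exact hj.ne h1
    · exact hi.ne' h.1
  have h := hx.rate_nonpos hcl hle (hxs.K_ne_zero hi) hbal
    (dz := fun k l => unitDir j t k l - unitDir i t k l) (dp := 0)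
    ⟨by simp, fun l => by rw [Finset.sum_sub_distrib, sum_unitDir, sum_unitDir, sub_self],
      fun k l hz => by
        have hne : ¬ (k = i ∧ l = t) := by rintro ⟨rfl, rfl⟩; exact hi.ne' hz
        have : unitDir i t k l = 0 := if_neg hne
        rw [this, sub_zero]; exact unitDir_nonneg j t k l,
      fun k l hz => by
        have hne : ¬ (k = j ∧ l = t) := by rintro ⟨rfl, rfl⟩; exact hj.ne hz
        have : unitDir j t k l = 0 := if_neg hne
        rw [this, zero_sub, neg_nonpos]; exact unitDir_nonneg i t k l,
      by simp⟩
    (fun k l hs => by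
      have h1 : ¬ (k = i ∧ l = t) := by rintro ⟨rfl, rfl⟩; exact his hs
      have h2 : ¬ (k = j ∧ l = t) := by rintro ⟨rfl, rfl⟩; exact hjs hs
      simp [unitDir, h1, h2])
  simp only [Pi.zero_apply, mul_zero, add_zero, mul_sub, ← mul_assoc, Finset.sum_sub_distrib,
    sum_mul_unitDir] at h
  linarith

/-- Power spent in slot `l` cannot be moved profitably to a slot `t` if energy causality permits
the move. -/
lemma IsRun.power_exchange {x : ℕ → Point M T} (hx : P.IsRun x) {xs : Point M T}
    (hcl : MapClusterPt xs atTop x) (hle : ∀ k, P.objective xs ≤ P.objective (x k))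
    (hbal : P.Balanced xs) {i : Fin M} {t l : Fin T} (hE : 0 < P.cumEnergy i t)
    (hl : 0 < xs.p i l)
    (htl : ∀ r, t ≤ r → r < l → P.Ts * ∑ q ∈ Finset.Iic r, xs.p i q ≠ P.cumEnergy i r) :
    P.gain xs i t * P.pRate xs i t ≤ P.gain xs i l * P.pRate xs i l := by
  have hxs := hx.feasible_of_mapClusterPt hcl
  rcases (hxs.z_mem i t).1.eq_or_lt with hz | hz
  · have : P.pRate xs i t = 0 := by simp [pRate, ← hz]
    rw [this, mul_zero]
    exact mul_nonneg (P.gain_nonneg xs i l) (hxs.pRate_nonneg i l)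
  have hts : ¬ P.IsStuck xs i t := by
    rintro (h | h)
    · exact hE.ne' h
    · exact hz.ne' h.1
  have hls : ¬ P.IsStuck xs i l := by
    rintro (h | h)
    · exact hl.ne' (hxs.p_eq_zero h)
    · exact hl.ne' h.2
  have h := hx.rate_nonpos hcl hle (hxs.K_ne_zero hz) hbal
    (dz := 0) (dp := fun k r => unitDir i t k r - unitDir i l k r)
    ⟨fun k r htight => by
        rw [Finset.sum_sub_distrib, sum_Iic_unitDir, sum_Iic_unitDir]
        by_cases h1 : k = i ∧ t ≤ r
        · obtain ⟨rfl, h1⟩ := h1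
          have h2 : l ≤ r := by
            by_contra! h2
            exact htl r h1 h2 htight
          simp [h1, h2]
        · rw [if_neg h1]; split_ifs <;> norm_num,
      by simp, by simp, by simp,
      fun k r hp => by
        have hne : ¬ (k = i ∧ r = l) := by rintro ⟨rfl, rfl⟩; exact hl.ne' hp
        have : unitDir i l k r = 0 := if_neg hne
        rw [this, sub_zero]; exact unitDir_nonneg i t k r⟩
    (fun k r hs => by
      have h1 : ¬ (k = i ∧ r = t) := by rintro ⟨rfl, rfl⟩; exact hts hs
      have h2 : ¬ (k = i ∧ r = l) := by rintro ⟨rfl, rfl⟩; exact hls hs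
      simp [unitDir, h1, h2])
  simp only [Pi.zero_apply, mul_zero, zero_add, mul_sub, ← mul_assoc, Finset.sum_sub_distrib,
    sum_mul_unitDir] at h
  linarith

/-- Power in slot `t` has no value if no energy constraint from `t` on is active. -/
lemma IsRun.power_worthless {x : ℕ → Point M T} (hx : P.IsRun x) {xs : Point M T}
    (hcl : MapClusterPt xs atTop x) (hle : ∀ k, P.objective xs ≤ P.objective (x k))
    (hbal : P.Balanced xs) {i : Fin M} {t : Fin T} (hE : 0 < P.cumEnergy i t)
    (htl : ∀ r, t ≤ r → P.Ts * ∑ q ∈ Finset.Iic r, xs.p i q ≠ P.cumEnergy i r) :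
    P.gain xs i t * P.pRate xs i t ≤ 0 := by
  have hxs := hx.feasible_of_mapClusterPt hcl
  rcases (hxs.z_mem i t).1.eq_or_lt with hz | hz
  · have : P.pRate xs i t = 0 := by simp [pRate, ← hz]
    rw [this, mul_zero]
  have hts : ¬ P.IsStuck xs i t := by
    rintro (h | h)
    · exact hE.ne' h
    · exact hz.ne' h.1
  have h := hx.rate_nonpos hcl hle (hxs.K_ne_zero hz) hbal (dz := 0) (dp := unitDir i t)
    ⟨fun k r htight => by
        rw [sum_Iic_unitDir, if_neg]
        rintro ⟨rfl, h1⟩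
        exact htl r h1 htight,
      by simp, by simp, by simp, fun k r _ => unitDir_nonneg i t k r⟩
    (fun k r hs => by
      have h1 : ¬ (k = i ∧ r = t) := by rintro ⟨rfl, rfl⟩; exact hts hs
      simp [unitDir, h1])
  simpa only [Pi.zero_apply, mul_zero, zero_add, ← mul_assoc, sum_mul_unitDir] using h

lemma IsRun.power_value_antitone {x : ℕ → Point M T} (hx : P.IsRun x) {xs : Point M T}
    (hcl : MapClusterPt xs atTop x) (hle : ∀ k, P.objective xs ≤ P.objective (x k))
    (hbal : P.Balanced xs) {i : Fin M} {l t : Fin T} (hl : 0 < xs.p i l) (hlt : l ≤ t) :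
    P.gain xs i t * P.pRate xs i t ≤ P.gain xs i l * P.pRate xs i l := by
  have hxs := hx.feasible_of_mapClusterPt hcl
  refine hx.power_exchange hcl hle hbal ?_ hl fun r h1 h2 => absurd (h1.trans_lt h2) hlt.not_gt
  exact (mul_pos P.Ts_pos hl).trans_le (hxs.p_le i hlt)

/-- If the energy constraint of slot `t` is slack, then power in slot `t` is worth at most as much
as in some later slot: the power spent before the next active constraint can be advanced. -/
lemma IsRun.power_value_le_later {x : ℕ → Point M T} (hx : P.IsRun x) {xs : Point M T}
    (hcl : MapClusterPt xs atTop x) (hle : ∀ k, P.objective xs ≤ P.objective (x k))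
    (hbal : P.Balanced xs) {i : Fin M} {t : Fin T}
    (hslack : P.Ts * ∑ q ∈ Finset.Iic t, xs.p i q ≠ P.cumEnergy i t) :
    P.gain xs i t * P.pRate xs i t ≤ 0 ∨
      ∃ l, t < l ∧ P.gain xs i t * P.pRate xs i t ≤ P.gain xs i l * P.pRate xs i l := by
  classical
  have hxs := hx.feasible_of_mapClusterPt hcl
  have hlt := lt_of_le_of_ne (hxs.2.1 i t) hslack
  have hE : 0 < P.cumEnergy i t :=
    (mul_nonneg P.Ts_pos.le (Finset.sum_nonneg fun q _ => hxs.p_nonneg i q)).trans_lt hlt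
  set A := Finset.univ.filter fun r => t ≤ r ∧
    P.Ts * ∑ q ∈ Finset.Iic r, xs.p i q = P.cumEnergy i r with hA
  rcases A.eq_empty_or_nonempty with hAe | hAne
  · refine Or.inl (hx.power_worthless hcl hle hbal hE fun r h1 h2 => ?_)
    have : r ∈ A := by simp [hA, h1, h2]
    simp [hAe] at this
  have hrA := A.min'_mem hAne
  set r := A.min' hAne
  obtain ⟨htr, hrt⟩ : t ≤ r ∧ P.Ts * ∑ q ∈ Finset.Iic r, xs.p i q = P.cumEnergy i r := by
    simpa [hA] using hrA
  obtain ⟨l, hl1, hl2, hl3⟩ : ∃ l, t < l ∧ l ≤ r ∧ 0 < xs.p i l := by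
    by_contra! hno
    have hsub : ∑ q ∈ Finset.Iic r, xs.p i q = ∑ q ∈ Finset.Iic t, xs.p i q := by
      refine (Finset.sum_subset (Finset.Iic_subset_Iic.2 htr) fun q hq hq' => ?_).symm
      rw [Finset.mem_Iic] at hq hq'
      exact le_antisymm (hno q (not_le.1 hq') hq) (hxs.p_nonneg i q)
    rw [hsub] at hrt
    linarith [P.cumEnergy_mono i htr]
  refine Or.inr ⟨l, hl1, hx.power_exchange hcl hle hbal hE hl3 fun q hq1 hq2 hq3 => ?_⟩
  have hq : q ∈ A := by simp [hA, hq1, hq3]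
  exact absurd (A.min'_le q hq) (not_le.2 (hq2.trans_le hl2))

/-! ### Multipliers -/

/-- A threshold that separates the values of the selected from those of the unselected indices:
the multiplier of the selection count. -/
lemma exists_threshold {ι : Type*} [Fintype ι] {w z : ι → ℝ} (hw : ∀ i, 0 ≤ w i)
    (hex : ∀ i j, 0 < z i → z j < 1 → w j ≤ w i) :
    ∃ ν : ℝ, (∀ i, 0 < z i → ν ≤ w i) ∧ ∀ j, z j < 1 → w j ≤ ν := by
  classical
  refine ⟨(Finset.univ.filter fun j => z j < 1).fold max 0 w, fun i hi => ?_, fun j hj => ?_⟩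
  · exact Finset.fold_max_le _ |>.2 ⟨hw i, fun j hj => hex i j hi (Finset.mem_filter.1 hj).2⟩
  · exact Finset.le_fold_max _ |>.2 (Or.inr ⟨j, by simp [hj], le_rfl⟩)

/-- The multipliers of nested partial-sum constraints: their tail sums form the least nonincreasing
majorant of the values `v`. -/
lemma exists_partialSum_multipliers {v p : Fin T → ℝ} {tight : Fin T → Prop}
    (hv : ∀ t, 0 ≤ v t) (hp : ∀ l t, 0 < p l → l ≤ t → v t ≤ v l)
    (hslack : ∀ t, ¬ tight t → v t ≤ 0 ∨ ∃ l, t < l ∧ v t ≤ v l) :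
    ∃ β : Fin T → ℝ, (∀ t, 0 ≤ β t) ∧ (∀ t, ¬ tight t → β t = 0) ∧
      (∀ t, v t ≤ ∑ l ∈ Finset.Ici t, β l) ∧
      ∀ t, 0 < p t → ∑ l ∈ Finset.Ici t, β l = v t := by
  classical
  set τ : ℕ → ℝ := fun n => (Finset.univ.filter fun l : Fin T => n ≤ l).fold max 0 v with hτ
  have hle : ∀ n c, τ n ≤ c ↔ 0 ≤ c ∧ ∀ l : Fin T, n ≤ l → v l ≤ c := fun n c => by
    simp only [hτ, Finset.fold_max_le, Finset.mem_filter, Finset.mem_univ, true_and]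
  have hge : ∀ (n : ℕ) (l : Fin T), n ≤ l → v l ≤ τ n := fun n => ((hle n _).1 le_rfl).2
  have hτ0 : ∀ n, 0 ≤ τ n := fun n => ((hle n _).1 le_rfl).1
  have hanti : ∀ n, τ (n + 1) ≤ τ n := fun n =>
    (hle _ _).2 ⟨hτ0 n, fun l hl => hge n l (by omega)⟩
  have hT : τ T = 0 := le_antisymm
    ((hle _ _).2 ⟨le_rfl, fun l hl => absurd l.2 (by omega)⟩) (hτ0 T)
  have hsum : ∀ t : Fin T, ∑ l ∈ Finset.Ici t, (τ l - τ (l + 1)) = τ t := by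
    intro t
    have h1 := Finset.sum_map (Finset.Ici t) Fin.valEmbedding fun n => τ n - τ (n + 1)
    rw [Fin.map_valEmbedding_Ici] at h1
    have h2 := Finset.sum_Ico_eq_sub (fun n => τ n - τ (n + 1)) t.2.le
    rw [Finset.sum_range_sub', Finset.sum_range_sub', hT] at h2
    exact h1.symm.trans (h2.trans (by ring))
  refine ⟨fun t => τ t - τ (t + 1), fun t => sub_nonneg.2 (hanti t), fun t ht => ?_,
    fun t => (hge t t le_rfl).trans_eq (hsum t).symm, fun t ht => (hsum t).trans ?_⟩
  · refine sub_eq_zero.2 (le_antisymm ((hle _ _).2 ⟨hτ0 _, fun l hl => ?_⟩) (hanti t))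
    rcases hl.eq_or_lt with h | h
    · rw [← Fin.ext h]
      rcases hslack t ht with h1 | ⟨q, hq, h1⟩
      · exact h1.trans (hτ0 _)
      · exact h1.trans (hge _ q hq)
    · exact hge _ l h
  · exact le_antisymm ((hle _ _).2 ⟨hv t, fun l hl => hp t l ht hl⟩) (hge t t le_rfl)

lemma Feasible.hasFDerivAt_ratio {x : Point M T} (h : P.Feasible x) (i : Fin M) (t : Fin T) :
    HasFDerivAt (fun y : Point M T => y.p i t * y.z i t / (y.p i t + P.xi i t))
      (P.zRate x i t • zCoord i t + P.pRate x i t • pCoord i t : Point M T →L[ℝ] ℝ) x := by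
  have hd := (h.denom_pos i t).ne'
  have hp := (pCoord i t : Point M T →L[ℝ] ℝ).hasFDerivAt (x := x)
  have hz := (zCoord i t : Point M T →L[ℝ] ℝ).hasFDerivAt (x := x)
  have hinv := (hasDerivAt_inv hd).comp_hasFDerivAt x (hp.add_const (P.xi i t))
  refine ((hp.mul hz).mul hinv).congr_fderiv (ContinuousLinearMap.ext fun v => ?_)
  simp only [add_apply, smul_apply, smul_eq_mul, zCoord_apply, pCoord_apply, zRate, pRate,
    Function.comp_apply, Pi.mul_apply]
  field_simp
  ring

lemma Feasible.hasFDerivAt_lagrangian {x : Point M T} (h : P.Feasible x)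
    (w : Multipliers M T) :
    HasFDerivAt (P.lagrangian w) (-∑ t, ∑ i, P.gain x i t • sCoord i t
      + ∑ i, ∑ t, w.lam i t •
        (sCoord i t - (P.zRate x i t • zCoord i t + P.pRate x i t • pCoord i t))
      + ∑ i, ∑ t, w.beta i t • (P.Ts • ∑ l ∈ Finset.Iic t, pCoord i l)
      + ∑ t, w.nu t • ∑ i, zCoord i t
      - ∑ i, ∑ t, w.zlo i t • zCoord i t
      + ∑ i, ∑ t, w.zup i t • zCoord i t
      - ∑ i, ∑ t, w.eta i t • pCoord i t
      - ∑ i, ∑ t, w.theta i t • sCoord i t : Point M T →L[ℝ] ℝ) x := by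
  have hz := fun i t => (zCoord i t : Point M T →L[ℝ] ℝ).hasFDerivAt (x := x)
  have hs := fun i t => (sCoord i t : Point M T →L[ℝ] ℝ).hasFDerivAt (x := x)
  have hp := fun i t => (pCoord i t : Point M T →L[ℝ] ℝ).hasFDerivAt (x := x)
  refine (((((((P.hasFDerivAt_objective h.s_nonneg).add ?_).add ?_).add ?_).sub ?_).add ?_).sub
    ?_).sub ?_
  · exact HasFDerivAt.fun_sum fun i _ => HasFDerivAt.fun_sum fun t _ =>
      ((hs i t).sub (h.hasFDerivAt_ratio i t)).const_mul _
  · exact HasFDerivAt.fun_sum fun i _ => HasFDerivAt.fun_sum fun t _ =>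
      (((HasFDerivAt.fun_sum fun l _ => hp i l).const_mul P.Ts).sub_const _).const_mul _
  · exact HasFDerivAt.fun_sum fun t _ =>
      ((HasFDerivAt.fun_sum fun i _ => hz i t).sub_const _).const_mul _
  · exact HasFDerivAt.fun_sum fun i _ => HasFDerivAt.fun_sum fun t _ => (hz i t).const_mul _
  · exact HasFDerivAt.fun_sum fun i _ => HasFDerivAt.fun_sum fun t _ =>
      ((hz i t).sub_const 1).const_mul _
  · exact HasFDerivAt.fun_sum fun i _ => HasFDerivAt.fun_sum fun t _ => (hp i t).const_mul _
  · exact HasFDerivAt.fun_sum fun i _ => HasFDerivAt.fun_sum fun t _ => (hs i t).const_mul _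

/-- The Lagrangian is stationary once the coefficients of `z_i[t]`, `s_i[t]` and `p_i[t]` vanish. -/
lemma Feasible.lagrangian_stationary {x : Point M T} (h : P.Feasible x) {w : Multipliers M T}
    (hz : ∀ i t, w.nu t - w.lam i t * P.zRate x i t - w.zlo i t + w.zup i t = 0)
    (hs : ∀ i t, w.lam i t - P.gain x i t - w.theta i t = 0)
    (hp : ∀ i t, P.Ts * ∑ l ∈ Finset.Ici t, w.beta i l - w.lam i t * P.pRate x i t
      - w.eta i t = 0) :
    HasFDerivAt (P.lagrangian w) (0 : Point M T →L[ℝ] ℝ) x := by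
  refine (h.hasFDerivAt_lagrangian w).congr_fderiv (ContinuousLinearMap.ext fun v => ?_)
  have hβ : ∀ i, ∑ t, w.beta i t * (P.Ts * ∑ l ∈ Finset.Iic t, v.p i l)
      = ∑ t, (P.Ts * ∑ l ∈ Finset.Ici t, w.beta i l) * v.p i t := by
    intro i
    simp only [Finset.mul_sum, Finset.sum_mul]
    rw [Finset.sum_comm' (t' := Finset.univ) (s' := fun l => Finset.Ici l) (by simp)]
    refine Finset.sum_congr rfl fun t _ => Finset.sum_congr rfl fun l _ => ?_
    ring
  have hν : ∑ t, w.nu t * ∑ i, v.z i t = ∑ i, ∑ t, w.nu t * v.z i t := by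
    simp only [Finset.mul_sum]
    exact Finset.sum_comm
  simp only [add_apply, sub_apply, neg_apply, smul_apply, sum_apply, zero_apply, smul_eq_mul,
    zCoord_apply, sCoord_apply, pCoord_apply, hβ, hν]
  rw [Finset.sum_comm (f := fun t i => P.gain x i t * v.s i t)]
  simp only [← Finset.sum_neg_distrib, ← Finset.sum_add_distrib, ← Finset.sum_sub_distrib]
  refine Finset.sum_eq_zero fun i _ => Finset.sum_eq_zero fun t _ => ?_
  linear_combination v.z i t * hz i t + v.s i t * hs i t + v.p i t * hp i t

/-- Accumulation points of a run are KKT points. The multiplier of the constraint on `s_i[t]` is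
the gain, so the stationarity conditions in `z` and in `p` are those of two linear programs, whose
multipliers come from the exchange conditions. -/
lemma IsRun.isKKT {x : ℕ → Point M T} (hx : P.IsRun x) {xs : Point M T}
    (hcl : MapClusterPt xs atTop x) (hle : ∀ k, P.objective xs ≤ P.objective (x k))
    (hbal : P.Balanced xs) : P.IsKKT xs := by
  classical
  have hxs := hx.feasible_of_mapClusterPt hcl
  have hzr := fun i t => mul_nonneg (P.gain_nonneg xs i t) (hxs.zRate_nonneg i t)
  have hpr := fun i t => mul_nonneg (P.gain_nonneg xs i t) (hxs.pRate_nonneg i t)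
  choose ν hν1 hν2 using fun t => exists_threshold (w := fun i => P.gain xs i t * P.zRate xs i t)
    (z := fun i => xs.z i t) (fun i => hzr i t)
    fun i j hi hj => hx.weight_exchange hcl hle hbal hi hj
  choose β hβ0 hβs hβv hβp using fun i => exists_partialSum_multipliers
    (v := fun t => P.gain xs i t * P.pRate xs i t) (p := xs.p i)
    (tight := fun t => P.Ts * ∑ q ∈ Finset.Iic t, xs.p i q = P.cumEnergy i t) (hpr i)
    (fun l t hl hlt => hx.power_value_antitone hcl hle hbal hl hlt)
    fun t ht => hx.power_value_le_later hcl hle hbal ht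
  refine ⟨hxs, ⟨P.gain xs, fun i t => β i t / P.Ts, ν,
    fun i t => max (ν t - P.gain xs i t * P.zRate xs i t) 0,
    fun i t => max (P.gain xs i t * P.zRate xs i t - ν t) 0,
    fun i t => ∑ l ∈ Finset.Ici t, β i l - P.gain xs i t * P.pRate xs i t, 0⟩,
    fun i t => ⟨P.gain_nonneg xs i t, div_nonneg (hβ0 i t) P.Ts_pos.le, le_max_right _ _,
      le_max_right _ _, sub_nonneg.2 (hβv i t), le_rfl⟩, ?_, ?_, ?_, ?_, ?_, ?_, ?_⟩
  · intro i t
    rcases (P.gain_nonneg xs i t).eq_or_lt with hg | hg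
    · exact mul_eq_zero_of_left hg.symm _
    · have hc := hx.cons_eq_zero hcl hle hg
      refine mul_eq_zero_of_right _ (sub_eq_zero.2 ?_)
      rw [eq_div_iff (hxs.denom_pos i t).ne']
      unfold cons at hc
      linarith
  · intro i t
    by_cases ht : P.Ts * ∑ q ∈ Finset.Iic t, xs.p i q = P.cumEnergy i t
    · exact mul_eq_zero_of_right _ (sub_eq_zero.2 ht)
    · exact mul_eq_zero_of_left (by simp [hβs i t ht]) _
  · intro i t
    rcases (hxs.z_mem i t).1.eq_or_lt with hz | hz
    · exact mul_eq_zero_of_right _ hz.symm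
    · exact mul_eq_zero_of_left (max_eq_right (sub_nonpos.2 (hν1 t i hz))) _
  · intro i t
    rcases (hxs.z_mem i t).2.eq_or_lt with hz | hz
    · exact mul_eq_zero_of_right _ (sub_eq_zero.2 hz)
    · exact mul_eq_zero_of_left (max_eq_right (sub_nonpos.2 (hν2 t i hz))) _
  · intro i t
    rcases (hxs.p_nonneg i t).eq_or_lt with hp | hp
    · exact mul_eq_zero_of_right _ hp.symm
    · exact mul_eq_zero_of_left (sub_eq_zero.2 (hβp i t hp)) _
  · intro i t
    exact zero_mul _
  · refine hxs.lagrangian_stationary (fun i t => ?_) (fun i t => by simp) fun i t => ?_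
    · rcases le_total (ν t) (P.gain xs i t * P.zRate xs i t) with h | h
      · simp [max_eq_right (sub_nonpos.2 h), max_eq_left (sub_nonneg.2 h)]
      · simp [max_eq_right (sub_nonpos.2 h), max_eq_left (sub_nonneg.2 h)]
    · simp only [← Finset.sum_div]
      rw [mul_div_cancel₀ _ P.Ts_pos.ne']
      ring

/-! ### Convergence of the iterates -/

lemma IsRun.exists_mapClusterPt {x : ℕ → Point M T} (hx : P.IsRun x) :
    ∃ xs, MapClusterPt xs atTop x := by
  obtain ⟨xs, -, h⟩ := P.isCompact_feasible.exists_mapClusterPt_of_frequently (l := atTop)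
    (f := x) (Frequently.of_forall hx.feasible)
  exact ⟨xs, h⟩

lemma IsRun.exists_tendsto_objective {x : ℕ → Point M T} (hx : P.IsRun x) :
    ∃ d, Tendsto (fun k => P.objective (x k)) atTop (𝓝 d) :=
  ⟨_, tendsto_atTop_ciInf hx.antitone
    ⟨0, by rintro _ ⟨k, rfl⟩; exact P.objective_nonneg (hx.feasible k).s_nonneg⟩⟩

lemma IsRun.objective_eq_of_mapClusterPt {x : ℕ → Point M T} (hx : P.IsRun x) {d : ℝ}
    (hd : Tendsto (fun k => P.objective (x k)) atTop (𝓝 d)) {xs : Point M T}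
    (hcl : MapClusterPt xs atTop x) : P.objective xs = d := by
  have h := hcl.continuousAt_comp
    (P.continuousAt_objective (hx.feasible_of_mapClusterPt hcl).s_nonneg)
  have : (𝓝 (P.objective xs) ⊓ map (P.objective ∘ x) atTop).NeBot := h
  exact tendsto_nhds_unique (f := id) (l := 𝓝 (P.objective xs) ⊓ map (P.objective ∘ x) atTop)
    (tendsto_id.mono_left inf_le_left)
    ((tendsto_id'.2 (hd : map (P.objective ∘ x) atTop ≤ 𝓝 d)).mono_left inf_le_right)

/-- A sequence in a compact set eventually leaves every closed set that contains none of its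
accumulation points. -/
lemma eventually_notMem_of_mapClusterPt {X : Type*} [TopologicalSpace X] {C A : Set X}
    (hC : IsCompact C) (hA : IsClosed A) {u : ℕ → X} (hu : ∀ k, u k ∈ C)
    (h : ∀ a, MapClusterPt a atTop u → a ∉ A) : ∀ᶠ k in atTop, u k ∉ A := by
  by_contra hf
  have hf' : ∃ᶠ k in atTop, u k ∈ C ∩ A := fun h' => hf (h'.mono fun k hk hkA => hk ⟨hu k, hkA⟩)
  obtain ⟨a, ha, hcl⟩ := (hC.inter_right hA).exists_mapClusterPt_of_frequently hf'
  exact h a hcl ha.2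

lemma IsRun.tendsto_infDist {x : ℕ → Point M T} (hx : P.IsRun x) {S : Set (Point M T)}
    (hS : ∀ xs, MapClusterPt xs atTop x → xs ∈ S) :
    Tendsto (fun k => Metric.infDist (x k) S) atTop (𝓝 0) := by
  rw [Metric.tendsto_nhds]
  intro ε hε
  filter_upwards [eventually_notMem_of_mapClusterPt P.isCompact_feasible
    (A := {y | ε ≤ Metric.infDist y S})
    (isClosed_le continuous_const (Metric.continuous_infDist_pt S)) hx.feasible
    fun a ha hmem => by
      rw [Set.mem_ofPred_eq, Metric.infDist_zero_of_mem (hS a ha)] at hmem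
      linarith] with k hk
  rw [Real.dist_0_eq_abs, abs_of_nonneg Metric.infDist_nonneg]
  exact not_le.1 hk

lemma eq_of_prox_eq_zero {y x : Point M T} (h : ∀ i t, prox y x i t = 0) : x = y := by
  have key : ∀ i t, x.s i t = y.s i t ∧ x.p i t = y.p i t ∧ x.z i t = y.z i t := by
    intro i t
    have h1 := h i t
    unfold prox at h1
    have hs : x.s i t - y.s i t = 0 := by
      nlinarith [sq_nonneg (x.s i t - y.s i t), sq_nonneg (x.p i t - y.p i t),
        sq_nonneg ((x.z i t - y.z i t) + (x.p i t - y.p i t))]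
    have hp : x.p i t - y.p i t = 0 := by
      nlinarith [sq_nonneg (x.s i t - y.s i t), sq_nonneg (x.p i t - y.p i t),
        sq_nonneg ((x.z i t - y.z i t) + (x.p i t - y.p i t))]
    have hz : (x.z i t - y.z i t) + (x.p i t - y.p i t) = 0 := by
      nlinarith [sq_nonneg (x.s i t - y.s i t), sq_nonneg (x.p i t - y.p i t),
        sq_nonneg ((x.z i t - y.z i t) + (x.p i t - y.p i t))]
    exact ⟨by linarith, by linarith, by linarith⟩
  exact Prod.ext (funext fun i => funext fun t => (key i t).2.2)
    (Prod.ext (funext fun i => funext fun t => (key i t).1)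
      (funext fun i => funext fun t => (key i t).2.1))

/-- If `(a, b)` is a limit of pairs of consecutive iterates, then `cons b + prox a b ≤ 0`, while
the constraint is active at the accumulation point `b`; hence `a = b`. -/
lemma IsRun.tendsto_dist_succ {x : ℕ → Point M T} (hx : P.IsRun x) (ha : ∀ i, P.a i ≠ 0)
    (hle : ∀ xs, MapClusterPt xs atTop x → ∀ k, P.objective xs ≤ P.objective (x k)) :
    Tendsto (fun k => dist (x (k + 1)) (x k)) atTop (𝓝 0) := by
  rw [Metric.tendsto_nhds]
  intro ε hε
  filter_upwards [eventually_notMem_of_mapClusterPt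
    (P.isCompact_feasible.prod P.isCompact_feasible) (A := {w | ε ≤ dist w.2 w.1})
    (isClosed_le continuous_const (continuous_snd.dist continuous_fst))
    (u := fun k => (x k, x (k + 1))) (fun k => ⟨hx.feasible k, hx.feasible (k + 1)⟩)
    fun w hw hmem => by
      have hb : MapClusterPt w.2 atTop x := by
        have h1 : MapClusterPt w.2 atTop fun k => x (k + 1) :=
          hw.continuousAt_comp continuous_snd.continuousAt
        exact MapClusterPt.of_comp (tendsto_add_atTop_nat 1) h1
      have hfb := hx.feasible_of_mapClusterPt hb
      have hineq : ∀ i t, P.cons w.2 i t + prox w.1 w.2 i t ≤ 0 := fun i t =>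
        (isClosed_le (((P.continuous_cons i t).comp continuous_snd).add
          (continuous_prox continuous_fst continuous_snd i t))
          continuous_const).mem_of_mapClusterPt hw
          (Eventually.of_forall fun k => (P.surrogateFeasible_iff.1 (hx.2 k).1).1 i t)
      have heq : w.2 = w.1 := eq_of_prox_eq_zero fun i t => by
        have h1 := hineq i t
        rw [hx.cons_eq_zero hb (hle _ hb) (P.gain_pos hfb.s_nonneg (ha i) t), zero_add] at h1
        exact le_antisymm h1 (prox_nonneg _ _ i t)
      rw [Set.mem_ofPred_eq, heq, dist_self] at hmem
      linarith] with k hk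
  rw [Real.dist_0_eq_abs, abs_of_nonneg dist_nonneg]
  exact not_le.1 hk

/-- A sequence in a compact set with vanishing increments converges to any isolated accumulation
point: it finally cannot cross an annulus free of accumulation points. -/
lemma tendsto_of_isolated_mapClusterPt {X : Type*} [PseudoMetricSpace X] {C : Set X}
    (hC : IsCompact C) {u : ℕ → X} (hu : ∀ k, u k ∈ C)
    (hstep : Tendsto (fun k => dist (u (k + 1)) (u k)) atTop (𝓝 0)) {a : X}
    (ha : MapClusterPt a atTop u) {ε : ℝ} (hε : 0 < ε)
    (hiso : ∀ b, MapClusterPt b atTop u → dist b a < ε → b = a) :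
    Tendsto u atTop (𝓝 a) := by
  rw [Metric.tendsto_nhds]
  intro ρ hρ
  set δ := min (ε / 2) (ρ / 2) with hδ
  have hδ0 : 0 < δ := lt_min (by linarith) (by linarith)
  have hδε : δ < ε := (min_le_left _ _).trans_lt (by linarith)
  have hδρ : δ < ρ := (min_le_right _ _).trans_lt (by linarith)
  have hann := eventually_notMem_of_mapClusterPt hC
    (A := {y | δ / 2 ≤ dist y a} ∩ {y | dist y a ≤ δ})
    ((isClosed_le continuous_const (continuous_id.dist continuous_const)).inter
      (isClosed_le (continuous_id.dist continuous_const) continuous_const)) hu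
    fun b hb hmem => by
      have h1 : δ / 2 ≤ dist b a := hmem.1
      have h2 : dist b a ≤ δ := hmem.2
      rw [hiso b hb (h2.trans_lt hδε), dist_self] at h1
      linarith
  have hst : ∀ᶠ k in atTop, dist (u (k + 1)) (u k) < δ / 2 :=
    hstep.eventually (gt_mem_nhds (by linarith))
  obtain ⟨N, hN⟩ := eventually_atTop.1 (hann.and hst)
  obtain ⟨n, hn, hna⟩ := ((ha.frequently (Metric.ball_mem_nhds a (half_pos hδ0))).and_eventually
    (eventually_ge_atTop N)).exists
  filter_upwards [eventually_ge_atTop n] with k hk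
  have hkey : dist (u k) a < δ / 2 := by
    induction k, hk using Nat.le_induction with
    | base => exact hn
    | succ k hk ih =>
      by_contra! hge
      refine (hN (k + 1) (by omega)).1 ⟨hge, ?_⟩
      have h1 := (hN k (by omega)).2
      have h2 := dist_triangle (u (k + 1)) (u k) a
      change dist (u (k + 1)) a ≤ δ
      linarith
  linarith

end SensorNetwork

theorem proposition1 {m M T : ℕ} (P : SensorNetwork m M T) :
    -- the surrogate problem at a feasible point is solvable, so the algorithm can be run
    (∀ y, P.Feasible y → ∃ x, P.SolvesSurrogate y x) ∧
    ∀ x : ℕ → Point M T, P.IsRun x →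
      -- initially, a sensor that has harvested no energy carries selection weight in a slot only
      -- if all sensors that have harvested energy are fully selected in that slot
      (∀ t i j, P.cumEnergy i t = 0 → 0 < P.cumEnergy j t →
        (x 0).z i t = 0 ∨ (x 0).z j t = 1) →
      (∀ k, P.Feasible (x k)) ∧
      Antitone (fun k => P.objective (x k)) ∧
      (∃ d : ℝ, Tendsto (fun k => P.objective (x k)) atTop (𝓝 d) ∧
        (∃ xs, MapClusterPt xs atTop x) ∧
        (∀ xs, MapClusterPt xs atTop x → P.IsKKT xs ∧ P.objective xs = d) ∧
        Tendsto (fun k => Metric.infDist (x k) {y | P.IsKKT y ∧ P.objective y = d})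
          atTop (𝓝 0)) ∧
      ((∀ i, P.a i ≠ 0) →
        Tendsto (fun k => dist (x (k + 1)) (x k)) atTop (𝓝 0) ∧
        ∀ xs, MapClusterPt xs atTop x →
          (∃ ε > 0, ∀ y, P.IsKKT y → P.objective y = P.objective xs → dist y xs < ε → y = xs) →
          Tendsto x atTop (𝓝 xs)) := by

  refine ⟨fun y hy => P.exists_solvesSurrogate hy, fun x hx h0 => ?_⟩
  obtain ⟨d, hd⟩ := hx.exists_tendsto_objective
  have hval : ∀ xs, MapClusterPt xs atTop x → P.objective xs = d := fun xs hcl =>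
    hx.objective_eq_of_mapClusterPt hd hcl
  have hle : ∀ xs, MapClusterPt xs atTop x → ∀ k, P.objective xs ≤ P.objective (x k) :=
    fun xs hcl k => (hval xs hcl).trans_le (hx.antitone.le_of_tendsto hd k)
  have hkkt : ∀ xs, MapClusterPt xs atTop x → P.IsKKT xs := fun xs hcl =>
    hx.isKKT hcl (hle xs hcl) (hx.balanced_of_mapClusterPt h0 hcl)
  refine ⟨hx.feasible, hx.antitone, ⟨d, hd, hx.exists_mapClusterPt,
    fun xs hcl => ⟨hkkt xs hcl, hval xs hcl⟩,
    hx.tendsto_infDist fun xs hcl => ⟨hkkt xs hcl, hval xs hcl⟩⟩, fun ha => ?_⟩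
  have hstep := hx.tendsto_dist_succ ha hle
  refine ⟨hstep, fun xs hcl ⟨ε, hε, hiso⟩ => ?_⟩
  exact SensorNetwork.tendsto_of_isolated_mapClusterPt P.isCompact_feasible hx.feasible hstep hcl hε
    fun y hy => hiso y (hkkt y hy) ((hval y hy).trans (hval xs hcl).symm)
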